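/- **Theorem.** Fix $\omega,\lambda_1,\lambda_2>0$ and let $\gamma(k)=\big(\omega^2+\sum_{j=1}^2 2\lambda_j(1-\cos k_j)\big)^{1/2}$ for $k\in[-\pi,\pi]^2$. Split $[-\pi,\pi]^2=K_1\cup K_2\cup K_3$, where $K_1$ is the set of $k$ with $\det D^2\gamma(k)\neq0$, and a $k$ with $\det D^2\gamma(k)=0$ lies in $K_2$ or in $K_3$ according to whether $(\xi\cdot\nabla)^3\gamma(k)\ne 0$ or $=0$ for the null vector $\xi\neq 0$ of $D^2\gamma(k)$. Put $V_3=\nabla\gamma(K_3)$, $V_2=\nabla\gamma(K_2)\setminus V_3$, $V_1=\nabla\gamma(K_1)\setminus(V_2\cup V_3)$ and $V_0=\mathbb R^2\setminus\nabla\gamma([-\pi,\pi]^2)$. Let $\mathcal W(\ell^2(\mathbb Z^2))$ be the Weyl algebra, i.e. the $C^*$-algebra generated by unitaries $W(f)$, $f\in\ell^2(\mathbb Z^2)$, with $W(f)^*=W(-f)$ and $W(f)W(g)=e^{-\frac i2\operatorname{Im}\langle f,g\rangle}W(f+g)$, where $\langle f,g\rangle=\sum_x\overline{f(x)}g(x)$.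 Let $\tau_t$ be the harmonic dynamics on it: the $*$-automorphism with $\tau_t(W(f))=W(T_tf)$, where $T_t=(U+V)\mathcal F^{-1}M_t\mathcal F(U^*-V^*)$; here $\mathcal F:\ell^2(\mathbb Z^2)\to L^2([-\pi,\pi]^2)$ is the unitary Fourier transform, $M_t$ is multiplication by $e^{i\gamma t}$, $U=\frac i2\mathcal F^{-1}M_{\Gamma_+}\mathcal F$, $V=\frac i2\mathcal F^{-1}M_{\Gamma_-}\mathcal F J$, $\Gamma_\pm=\gamma^{-1/2}\pm\gamma^{1/2}$, $J$ is complex conjugation, and adjoints are taken with respect to the real inner product $\operatorname{Re}\langle\cdot,\cdot\rangle$. For $f,g\in\ell^1(\mathbb Z^2)$ write $X=\operatorname{supp} f$, $Y=\operatorname{supp} g$, $X-Y=\{x-y:x\in X,\,y\in Y\}$; distances between sets are infima of Euclidean distances. (1) For every $\delta>0$ there are constants $C=C(\delta)>0$ and $\mu=\mu(\delta)>0$ such that for all $t\in\mathbb R$ and all $f,g\in\ell^1(\mathbb Z^2)$ with $X-Y\subseteq tV_0$ and $\operatorname{dist}(X-Y,tV_1)\ge\delta|t|$, $$\|[\tau_t(W(f)),W(g)]\|\le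 C\,\|f\|_1\|g\|_1\,e^{-\mu\operatorname{dist}(X-Y,\,tV_1)}.$$ (2) For every $\mu>0$ there are constants $0<v_\mu\le\frac1\mu\big(1+2\sqrt{\lambda_1+\lambda_2}\,\sinh(\mu/2)\big)$ and $0<C_\mu<\omega+2\sqrt{\lambda_1+\lambda_2}\,\cosh(\mu/2)$ such that for all $t\in\mathbb R$ and all $f,g\in\ell^1(\mathbb Z^2)$, $$\|[\tau_t(W(f)),W(g)]\|\le\max\{1,C_\mu\}\,\|f\|_1\|g\|_1\,e^{-\mu(\operatorname{dist}(X,Y)-v_\mu|t|)}.$$ -/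

import Mathlib

open MeasureTheory
open scoped ENNReal Pointwise

namespace HarmonicLattice

noncomputable section

/-- The square lattice `ℤ²`. -/
abbrev Z2 : Type := Fin 2 → ℤ

/-- The parameters of the lattice: the on-site energy `ω > 0` and the coupling strengths
`λ₁, λ₂ > 0` (here `lam 0` and `lam 1`). -/
structure Params where
  ω : ℝ
  lam : Fin 2 → ℝ
  ω_pos : 0 < ω
  lam_pos : ∀ j, 0 < lam j

/-! ### The dispersion relation and the velocity sets -/

section Velocities

/-- The plane with its Euclidean norm; it carries both momenta and velocities. -/
abbrev Plane : Type := EuclideanSpace ℝ (Fin 2)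

variable (p : Params)

/-- The dispersion relation `γ(k) = (ω² + ∑ⱼ 2 λⱼ (1 - cos kⱼ))^{1/2}`. -/
def gamma (k : Plane) : ℝ :=
  √(p.ω ^ 2 + ∑ j, 2 * p.lam j * (1 - Real.cos (k j)))

/-- The momentum zone `[-π, π]²`. -/
def zone : Set Plane := {k | ∀ j, k j ∈ Set.Icc (-Real.pi) Real.pi}

/-- The Hessian matrix `D²γ(k)`. -/
def hessian (k : Plane) : Matrix (Fin 2) (Fin 2) ℝ :=
  Matrix.of fun i j => iteratedFDeriv ℝ 2 (gamma p) k
    ![EuclideanSpace.single i 1, EuclideanSpace.single j 1]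

/-- `ξ` is an eigenvector of `D²γ(k)` for the eigenvalue `0`. -/
def IsNullVector (k ξ : Plane) : Prop := ξ ≠ 0 ∧ (hessian p k).mulVec ξ.ofLp = 0

/-- The third directional derivative `(ξ · ∇)³ γ(k)`. -/
def thirdDeriv (k ξ : Plane) : ℝ := iteratedFDeriv ℝ 3 (gamma p) k fun _ => ξ

/-- The non-degenerate momenta. -/
def K1 : Set Plane := {k | k ∈ zone ∧ (hessian p k).det ≠ 0}

/-- The momenta with a fold degeneracy. -/
def K2 : Set Plane :=
  {k | k ∈ zone ∧ (hessian p k).det = 0 ∧ ∀ ξ, IsNullVector p k ξ → thirdDeriv p k ξ ≠ 0}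

/-- The momenta with a higher degeneracy. -/
def K3 : Set Plane :=
  {k | k ∈ zone ∧ (hessian p k).det = 0 ∧ ∃ ξ, IsNullVector p k ξ ∧ thirdDeriv p k ξ = 0}

/-- The group velocities `∇γ(k)` with `k ∈ K₃`. -/
def V3 : Set Plane := {v | ∃ k ∈ K3 p, v = gradient (gamma p) k}

/-- The group velocities `∇γ(k)` with `k ∈ K₂`, outside `V₃`. -/
def V2 : Set Plane := {v | v ∉ V3 p ∧ ∃ k ∈ K2 p, v = gradient (gamma p) k}

/-- The group velocities `∇γ(k)` with `k ∈ K₁`, outside `V₂ ∪ V₃`. -/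
def V1 : Set Plane := {v | v ∉ V2 p ∪ V3 p ∧ ∃ k ∈ K1 p, v = gradient (gamma p) k}

/-- The velocities that are not group velocities. -/
def V0 : Set Plane := {v | ∀ k ∈ zone, v ≠ gradient (gamma p) k}

/-- A lattice point as a point of the Euclidean plane. -/
def toPlane (x : Z2) : Plane := WithLp.toLp 2 fun j => (x j : ℝ)

/-- The distance `inf {|a - b| : a ∈ A, b ∈ B}` of two sets. -/
def setDist (A B : Set Plane) : ℝ := sInf (Set.image2 dist A B)

end Velocities

/-! ### The one-particle space `ℓ²(ℤ²)` and the Fourier transform -/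

/-- The Hilbert space `ℓ²(ℤ²)`. It is a type of its own so that its real structure is the one
induced by the complex structure. -/
def L2Z : Type := lp (fun _ : Z2 => ℂ) 2

instance : NormedAddCommGroup L2Z :=
  inferInstanceAs (NormedAddCommGroup (lp (fun _ : Z2 => ℂ) 2))

instance : InnerProductSpace ℂ L2Z :=
  inferInstanceAs (InnerProductSpace ℂ (lp (fun _ : Z2 => ℂ) 2))

instance : CompleteSpace L2Z :=
  inferInstanceAs (CompleteSpace (lp (fun _ : Z2 => ℂ) 2))

instance : CoeFun L2Z fun _ => Z2 → ℂ := ⟨fun f => f.1⟩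

/-- The real inner product `Re ⟨f, g⟩`; adjoints of real-linear maps refer to it. -/
instance : InnerProductSpace ℝ L2Z := InnerProductSpace.complexToReal

/-- The normalized Haar measure on the torus `(ℝ/ℤ)²`. A point `θ` of the torus stands for the
momentum `k = 2πθ`. -/
def torusMeasure : Measure (UnitAddTorus (Fin 2)) := Measure.pi fun _ => AddCircle.haarAddCircle

instance : IsProbabilityMeasure torusMeasure := by
  unfold torusMeasure; infer_instance

/-- `L²` of the momentum torus. -/
abbrev L2T : Type := Lp ℂ 2 torusMeasure

/-- The unitary Fourier transform `f ↦ ∑ₓ f(x) e^{2πi x·θ} = ∑ₓ f(x) e^{i k·x}`. -/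
def fourierTransform : L2Z ≃ₗᵢ[ℂ] L2T := (UnitAddTorus.mFourierBasis (d := Fin 2)).repr.symm

/-- Multiplication by a continuous function on `L²` of the torus. -/
def mulOp (φ : C(UnitAddTorus (Fin 2), ℂ)) : L2T →L[ℂ] L2T :=
  (ContinuousLinearMap.mul ℂ ℂ).holderL torusMeasure ∞ 2 2 (ContinuousMap.toLp ∞ torusMeasure ℂ φ)

/-- The Fourier multiplier `𝓕⁻¹ M_φ 𝓕`. -/
def multiplier (φ : C(UnitAddTorus (Fin 2), ℂ)) : L2Z →L[ℂ] L2Z :=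
  (fourierTransform.symm : L2T →L[ℂ] L2Z) ∘L mulOp φ ∘L (fourierTransform : L2Z →L[ℂ] L2T)

lemma coeFn_mulOp (φ : C(UnitAddTorus (Fin 2), ℂ)) (u : L2T) :
    (mulOp φ u : UnitAddTorus (Fin 2) → ℂ) =ᵐ[torusMeasure] fun θ => φ θ * u θ := by
  have h1 := (ContinuousLinearMap.mul ℂ ℂ).coeFn_holder (r := 2)
    (ContinuousMap.toLp ∞ torusMeasure ℂ φ) u
  have h2 := ContinuousMap.coeFn_toLp (p := ∞) torusMeasure (𝕜 := ℂ) φ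
  filter_upwards [h1, h2] with θ a b
  rw [← b]
  exact a

lemma mulOp_mul (φ ψ : C(UnitAddTorus (Fin 2), ℂ)) (u : L2T) :
    mulOp φ (mulOp ψ u) = mulOp (φ * ψ) u := by
  apply Lp.ext
  filter_upwards [coeFn_mulOp φ (mulOp ψ u), coeFn_mulOp ψ u, coeFn_mulOp (φ * ψ) u] with θ a b c
  rw [a, b, c]
  simp [mul_assoc]

lemma mulOp_one (u : L2T) : mulOp 1 u = u := by
  apply Lp.ext
  filter_upwards [coeFn_mulOp 1 u] with θ a
  rw [a]; simp

lemma mulOp_add (φ ψ : C(UnitAddTorus (Fin 2), ℂ)) (u : L2T) :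
    mulOp (φ + ψ) u = mulOp φ u + mulOp ψ u := by
  simp [mulOp]

lemma inner_mulOp (φ : C(UnitAddTorus (Fin 2), ℂ)) (u v : L2T) :
    inner ℂ (mulOp φ u) v = inner ℂ u (mulOp (star φ) v) := by
  rw [L2.inner_def, L2.inner_def]
  apply integral_congr_ae
  filter_upwards [coeFn_mulOp φ u, coeFn_mulOp (star φ) v] with θ a b
  rw [a, b]
  simp [RCLike.inner_apply]
  ring

lemma multiplier_mul (φ ψ : C(UnitAddTorus (Fin 2), ℂ)) (f : L2Z) :
    multiplier φ (multiplier ψ f) = multiplier (φ * ψ) f := by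
  simp [multiplier, mulOp_mul]

lemma multiplier_one (f : L2Z) : multiplier 1 f = f := by
  simp [multiplier, mulOp_one]

lemma inner_multiplier (φ : C(UnitAddTorus (Fin 2), ℂ)) (f g : L2Z) :
    inner ℂ (multiplier φ f) g = inner ℂ f (multiplier (star φ) g) := by
  have h := inner_mulOp φ (fourierTransform f) (fourierTransform g)
  rw [← fourierTransform.inner_map_map f, ← fourierTransform.inner_map_map (multiplier φ f)]
  simpa [multiplier] using h

/-- Complex conjugation `J` on `ℓ²(ℤ²)`. -/
def conjL2 : L2Z →L[ℝ] L2Z :=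
  LinearMap.mkContinuous
    { toFun := fun f => (star (show lp (fun _ : Z2 => ℂ) 2 from f) : lp (fun _ : Z2 => ℂ) 2)
      map_add' := fun f g => star_add (show lp (fun _ : Z2 => ℂ) 2 from f) g
      map_smul' := fun r f => by
        have h := star_smul (r : ℂ) (show lp (fun _ : Z2 => ℂ) 2 from f)
        rw [Complex.star_def, Complex.conj_ofReal] at h
        exact h } 1
    (fun f => by
      rw [one_mul]
      exact (norm_star (show lp (fun _ : Z2 => ℂ) 2 from f)).le)

lemma conjL2_apply (f : L2Z) (x : Z2) : conjL2 f x = star (f x) := rfl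

lemma L2Z.ext {f g : L2Z} (h : ∀ x, f x = g x) : f = g := Subtype.ext (funext h)

lemma inner_eq_tsum (f g : L2Z) : inner ℂ f g = ∑' x, inner ℂ (f x) (g x) := rfl

lemma conjL2_conjL2 (f : L2Z) : conjL2 (conjL2 f) = f :=
  L2Z.ext fun x => by simp [conjL2_apply]

lemma conjL2_smul (c : ℂ) (f : L2Z) : conjL2 (c • f) = star c • conjL2 f :=
  star_smul c (show lp (fun _ : Z2 => ℂ) 2 from f)

lemma inner_conjL2 (f g : L2Z) : inner ℂ (conjL2 f) (conjL2 g) = star (inner ℂ f g) := by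
  rw [inner_eq_tsum, inner_eq_tsum, tsum_star]
  refine tsum_congr fun x => ?_
  rw [conjL2_apply, conjL2_apply]
  simp [RCLike.inner_apply]

lemma fourierTransform_symm_apply (u : L2T) (n : Z2) :
    fourierTransform.symm u n = ∫ θ, UnitAddTorus.mFourier (-n) θ * u θ ∂torusMeasure :=
  UnitAddTorus.mFourierBasis_repr u n

instance : torusMeasure.IsNegInvariant := by
  have : ∀ _ : Fin 2, (AddCircle.haarAddCircle : Measure UnitAddCircle).IsNegInvariant :=
    fun _ => Measure.IsAddHaarMeasure.isNegInvariant_of_regular _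
  unfold torusMeasure
  infer_instance

lemma fourierTransform_symm_conj {u v : L2T}
    (h : (v : UnitAddTorus (Fin 2) → ℂ) =ᵐ[torusMeasure] fun θ => star (u (-θ))) :
    fourierTransform.symm v = conjL2 (fourierTransform.symm u) := by
  refine L2Z.ext fun n => ?_
  rw [conjL2_apply, fourierTransform_symm_apply, fourierTransform_symm_apply]
  rw [Complex.star_def, ← integral_conj,
    ← integral_neg_eq_self (fun θ => (starRingEnd ℂ) (UnitAddTorus.mFourier (-n) θ * u θ))]
  apply integral_congr_ae
  filter_upwards [h] with θ a
  rw [a, map_mul, ← UnitAddTorus.mFourier_neg, neg_neg]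
  congr 1
  simp [UnitAddTorus.mFourier]

lemma measurePreserving_neg_torus :
    MeasurePreserving (fun θ : UnitAddTorus (Fin 2) => -θ) torusMeasure torusMeasure :=
  Measure.measurePreserving_neg torusMeasure

lemma coeFn_fourierTransform_conj (f : L2Z) :
    (fourierTransform (conjL2 f) : UnitAddTorus (Fin 2) → ℂ)
      =ᵐ[torusMeasure] fun θ => star ((fourierTransform f : UnitAddTorus (Fin 2) → ℂ) (-θ)) := by
  set u := fourierTransform f with hu
  have hm : MemLp (fun θ => star ((u : UnitAddTorus (Fin 2) → ℂ) (-θ))) 2 torusMeasure :=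
    ((Lp.memLp u).comp_measurePreserving measurePreserving_neg_torus).star
  have h := fourierTransform_symm_conj (u := u) (v := hm.toLp) hm.coeFn_toLp
  have hf : fourierTransform.symm u = f := by simp [hu]
  rw [hf] at h
  rw [← h]
  simpa using hm.coeFn_toLp

lemma multiplier_conj (φ : C(UnitAddTorus (Fin 2), ℂ)) (hφ : ∀ θ, star (φ (-θ)) = φ θ) (f : L2Z) :
    multiplier φ (conjL2 f) = conjL2 (multiplier φ f) := by
  change fourierTransform.symm (mulOp φ (fourierTransform (conjL2 f)))
    = conjL2 (fourierTransform.symm (mulOp φ (fourierTransform f)))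
  apply fourierTransform_symm_conj
  have h2 := measurePreserving_neg_torus.quasiMeasurePreserving.ae
    (coeFn_mulOp φ (fourierTransform f))
  filter_upwards [coeFn_mulOp φ (fourierTransform (conjL2 f)), coeFn_fourierTransform_conj f, h2]
    with θ a b c
  rw [a, b, c, star_mul', hφ]

variable (p : Params)

/-- The dispersion relation on the torus, `θ ↦ γ(2πθ)`; note `Re (fourier 1 θⱼ) = cos (2πθⱼ)`. -/
def gammaTorus (θ : UnitAddTorus (Fin 2)) : ℝ :=
  √(p.ω ^ 2 + ∑ j, 2 * p.lam j * (1 - (fourier 1 (θ j) : ℂ).re))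

lemma gammaTorus_coe (k : Plane) :
    gammaTorus p (fun j => ((k j / (2 * Real.pi) : ℝ) : UnitAddCircle)) = gamma p k := by
  unfold gammaTorus gamma
  congr 2
  refine Finset.sum_congr rfl fun j _ => ?_
  rw [fourier_coe_apply]
  have h : 2 * (Real.pi : ℂ) * Complex.I * ((1 : ℤ) : ℂ) * ((k j / (2 * Real.pi) : ℝ) : ℂ)
      / ((1 : ℝ) : ℂ) = (k j : ℂ) * Complex.I := by
    have : (Real.pi : ℂ) ≠ 0 := Complex.ofReal_ne_zero.2 Real.pi_ne_zero
    push_cast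
    field_simp
  rw [h, Complex.exp_ofReal_mul_I_re]

lemma gammaTorus_pos (θ : UnitAddTorus (Fin 2)) : 0 < gammaTorus p θ := by
  apply Real.sqrt_pos.2
  have h : 0 ≤ ∑ j, 2 * p.lam j * (1 - (fourier 1 (θ j) : ℂ).re) := by
    refine Finset.sum_nonneg fun j _ => mul_nonneg (by linarith [p.lam_pos j]) ?_
    have h1 := Complex.re_le_norm (fourier 1 (θ j) : ℂ)
    have h2 : ‖(fourier 1 (θ j) : ℂ)‖ = 1 := by
      rw [fourier_apply]; exact Circle.norm_coe _
    linarith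
  have := p.ω_pos
  positivity

lemma continuous_gammaTorus : Continuous (gammaTorus p) := by
  unfold gammaTorus
  refine Real.continuous_sqrt.comp (continuous_const.add (continuous_finsetSum _ fun j _ => ?_))
  refine continuous_const.mul (continuous_const.sub (Complex.continuous_re.comp ?_))
  exact (fourier 1 : C(UnitAddCircle, ℂ)).continuous.comp (continuous_apply j)

lemma gammaTorus_neg (θ : UnitAddTorus (Fin 2)) : gammaTorus p (-θ) = gammaTorus p θ := by
  simp only [gammaTorus, Pi.neg_apply]
  have h : ∀ j, (fourier 1 (-θ j) : ℂ).re = (fourier 1 (θ j) : ℂ).re := fun j => by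
    have : (fourier 1 (-θ j) : ℂ) = (starRingEnd ℂ) (fourier 1 (θ j) : ℂ) := by
      rw [← fourier_neg]; simp
    rw [this, Complex.conj_re]
  simp only [h]

/-- `Γ₊ = γ^{-1/2} + γ^{1/2}`. -/
def gammaPlus : C(UnitAddTorus (Fin 2), ℂ) where
  toFun θ := ((1 / √(gammaTorus p θ) + √(gammaTorus p θ) : ℝ) : ℂ)
  continuous_toFun := by
    have h := continuous_gammaTorus p
    exact Complex.continuous_ofReal.comp ((continuous_const.div h.sqrt fun θ =>
      (Real.sqrt_pos.2 (gammaTorus_pos p θ)).ne').add h.sqrt)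

/-- `Γ₋ = γ^{-1/2} - γ^{1/2}`. -/
def gammaMinus : C(UnitAddTorus (Fin 2), ℂ) where
  toFun θ := ((1 / √(gammaTorus p θ) - √(gammaTorus p θ) : ℝ) : ℂ)
  continuous_toFun := by
    have h := continuous_gammaTorus p
    exact Complex.continuous_ofReal.comp ((continuous_const.div h.sqrt fun θ =>
      (Real.sqrt_pos.2 (gammaTorus_pos p θ)).ne').sub h.sqrt)

/-- The phase `e^{iγt}`. -/
def phase (t : ℝ) : C(UnitAddTorus (Fin 2), ℂ) where
  toFun θ := Complex.exp (Complex.I * gammaTorus p θ * t)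
  continuous_toFun := by
    have h := continuous_gammaTorus p
    fun_prop

/-- The Bogoliubov transformation `U = (i/2) 𝓕⁻¹ M_{Γ₊} 𝓕`. -/
def bogoliubovU : L2Z →L[ℝ] L2Z := (Complex.I / 2) • (multiplier (gammaPlus p)).restrictScalars ℝ

/-- The Bogoliubov transformation `V = (i/2) 𝓕⁻¹ M_{Γ₋} 𝓕 J`. -/
def bogoliubovV : L2Z →L[ℝ] L2Z :=
  (Complex.I / 2) • ((multiplier (gammaMinus p)).restrictScalars ℝ ∘L conjL2)

/-- The one-particle evolution `T_t = (U + V) 𝓕⁻¹ M_t 𝓕 (U* - V*)`, a real-linear map. -/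
def evolve (t : ℝ) : L2Z →L[ℝ] L2Z :=
  (bogoliubovU p + bogoliubovV p) ∘L
    ((fourierTransform.symm : L2T →L[ℂ] L2Z) ∘L mulOp (phase p t) ∘L
      (fourierTransform : L2Z →L[ℂ] L2T)).restrictScalars ℝ ∘L
    (ContinuousLinearMap.adjoint (bogoliubovU p) - ContinuousLinearMap.adjoint (bogoliubovV p))

/-- The symplectic form `σ(f, g) = Im ⟨f, g⟩`. -/
def sigma (f g : L2Z) : ℝ := (inner ℂ f g).im

lemma real_inner_L2Z (f g : L2Z) : inner ℝ f g = (inner ℂ f g).re := rfl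

lemma gammaPlus_symm (θ) : star (gammaPlus p (-θ)) = gammaPlus p θ := by
  simp only [gammaPlus, ContinuousMap.coe_mk, gammaTorus_neg, Complex.star_def, Complex.conj_ofReal]

lemma gammaMinus_symm (θ) : star (gammaMinus p (-θ)) = gammaMinus p θ := by
  simp only [gammaMinus, ContinuousMap.coe_mk, gammaTorus_neg, Complex.star_def,
    Complex.conj_ofReal]

lemma star_gammaPlus : star (gammaPlus p) = gammaPlus p := by
  ext θ
  simp only [gammaPlus, ContinuousMap.star_apply, ContinuousMap.coe_mk, Complex.star_def,
    Complex.conj_ofReal]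

lemma star_gammaMinus : star (gammaMinus p) = gammaMinus p := by
  ext θ
  simp only [gammaMinus, ContinuousMap.star_apply, ContinuousMap.coe_mk, Complex.star_def,
    Complex.conj_ofReal]

lemma adjoint_bogoliubovU (f : L2Z) :
    ContinuousLinearMap.adjoint (bogoliubovU p) f = -(Complex.I / 2) • multiplier (gammaPlus p) f := by
  have h : ContinuousLinearMap.adjoint (bogoliubovU p)
      = (-(Complex.I / 2)) • (multiplier (gammaPlus p)).restrictScalars ℝ := by
    symm
    rw [ContinuousLinearMap.eq_adjoint_iff]
    intro x y
    rw [real_inner_L2Z, real_inner_L2Z]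
    change (inner ℂ (-(Complex.I / 2) • multiplier (gammaPlus p) x) y).re
      = (inner ℂ x ((Complex.I / 2) • multiplier (gammaPlus p) y)).re
    rw [inner_smul_left, inner_smul_right, inner_multiplier, star_gammaPlus]
    congr 2
    simp [Complex.conj_ofNat, neg_div]
  rw [h]; rfl

lemma adjoint_bogoliubovV (f : L2Z) :
    ContinuousLinearMap.adjoint (bogoliubovV p) f
      = (Complex.I / 2) • multiplier (gammaMinus p) (conjL2 f) := by
  have h : ContinuousLinearMap.adjoint (bogoliubovV p) = bogoliubovV p := by
    symm
    rw [ContinuousLinearMap.eq_adjoint_iff]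
    intro x y
    rw [real_inner_L2Z, real_inner_L2Z]
    change (inner ℂ ((Complex.I / 2) • multiplier (gammaMinus p) (conjL2 x)) y).re
      = (inner ℂ x ((Complex.I / 2) • multiplier (gammaMinus p) (conjL2 y))).re
    rw [inner_smul_left, inner_smul_right, inner_multiplier, star_gammaMinus,
      multiplier_conj _ (gammaMinus_symm p)]
    rw [← conjL2_conjL2 (multiplier (gammaMinus p) y), inner_conjL2, conjL2_conjL2]
    rw [← Complex.conj_re]
    simp [Complex.conj_ofNat]
  rw [h]; rfl

/-- The common form of the two outer factors. -/
def bogoliubovSum (f : L2Z) : L2Z :=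
  (Complex.I / 2) • (multiplier (gammaPlus p) f + multiplier (gammaMinus p) (conjL2 f))

lemma evolve_apply (t : ℝ) (f : L2Z) :
    evolve p t f = bogoliubovSum p (multiplier (phase p t) (-bogoliubovSum p f)) := by
  have h : (ContinuousLinearMap.adjoint (bogoliubovU p) - ContinuousLinearMap.adjoint (bogoliubovV p)) f
      = -bogoliubovSum p f := by
    rw [sub_apply, adjoint_bogoliubovU, adjoint_bogoliubovV, bogoliubovSum]
    module
  have h2 : ∀ g, (bogoliubovU p + bogoliubovV p) g = bogoliubovSum p g := fun g => by
    rw [bogoliubovSum, smul_add]; rfl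
  rw [evolve, ContinuousLinearMap.comp_apply, ContinuousLinearMap.comp_apply, h, h2]
  rfl

lemma gamma_sq_sub (f : L2Z) :
    multiplier (gammaPlus p) (multiplier (gammaPlus p) f)
      - multiplier (gammaMinus p) (multiplier (gammaMinus p) f) = (4 : ℂ) • f := by
  have h : gammaPlus p * gammaPlus p = gammaMinus p * gammaMinus p + (4 : ℂ) • 1 := by
    ext θ
    have h1 := (Real.sqrt_pos.2 (gammaTorus_pos p θ)).ne'
    simp only [gammaPlus, gammaMinus, ContinuousMap.mul_apply, ContinuousMap.add_apply,
      ContinuousMap.smul_apply, ContinuousMap.coe_mk, ContinuousMap.one_apply]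
    have h3 : (1 / √(gammaTorus p θ) + √(gammaTorus p θ)) *
        (1 / √(gammaTorus p θ) + √(gammaTorus p θ)) = (1 / √(gammaTorus p θ) - √(gammaTorus p θ)) *
        (1 / √(gammaTorus p θ) - √(gammaTorus p θ)) + 4 := by
      field_simp; ring
    rw [← Complex.ofReal_mul, h3]
    push_cast
    simp
  rw [multiplier_mul, multiplier_mul, h]
  have h4 : multiplier (gammaMinus p * gammaMinus p + (4 : ℂ) • 1) f
      = multiplier (gammaMinus p * gammaMinus p) f + (4 : ℂ) • multiplier 1 f := by
    simp [multiplier, mulOp]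
  rw [h4, multiplier_one]
  module

lemma bogoliubovSum_neg (f : L2Z) : bogoliubovSum p (-f) = -bogoliubovSum p f := by
  simp only [bogoliubovSum, map_neg]; module

lemma bogoliubovSum_bogoliubovSum (f : L2Z) : bogoliubovSum p (bogoliubovSum p f) = -f := by
  have hJ : conjL2 ((Complex.I / 2) • (multiplier (gammaPlus p) f
      + multiplier (gammaMinus p) (conjL2 f)))
      = -(Complex.I / 2) • (multiplier (gammaPlus p) (conjL2 f) + multiplier (gammaMinus p) f) := by
    rw [conjL2_smul, map_add, ← multiplier_conj _ (gammaPlus_symm p),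
      ← multiplier_conj _ (gammaMinus_symm p), conjL2_conjL2]
    congr 1
    simp [neg_div]
  have hc : multiplier (gammaPlus p) (multiplier (gammaMinus p) (conjL2 f))
      = multiplier (gammaMinus p) (multiplier (gammaPlus p) (conjL2 f)) := by
    rw [multiplier_mul, multiplier_mul, mul_comm]
  have hs := eq_add_of_sub_eq (gamma_sq_sub p f)
  unfold bogoliubovSum
  rw [hJ]
  simp only [map_smul, map_add, hc, hs]
  have hI : Complex.I * Complex.I = -1 := Complex.I_mul_I
  match_scalars <;> ring_nf <;> simp

lemma sigma_bogoliubovSum (f g : L2Z) : sigma (bogoliubovSum p f) (bogoliubovSum p g) = sigma f g := by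
  have hs := eq_add_of_sub_eq (gamma_sq_sub p g)
  have hc : ∀ h : L2Z, multiplier (gammaPlus p) (multiplier (gammaMinus p) h)
      = multiplier (gammaMinus p) (multiplier (gammaPlus p) h) := fun h => by
    rw [multiplier_mul, multiplier_mul, mul_comm]
  have e1 : inner ℂ (conjL2 f) (multiplier (gammaMinus p) (multiplier (gammaMinus p) (conjL2 g)))
      = star (inner ℂ f (multiplier (gammaMinus p) (multiplier (gammaMinus p) g))) := by
    rw [multiplier_conj _ (gammaMinus_symm p), multiplier_conj _ (gammaMinus_symm p), inner_conjL2]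
  have e2 : inner ℂ (conjL2 f) (multiplier (gammaMinus p) (multiplier (gammaPlus p) g))
      = star (inner ℂ f (multiplier (gammaMinus p) (multiplier (gammaPlus p) (conjL2 g)))) := by
    rw [multiplier_conj _ (gammaPlus_symm p), multiplier_conj _ (gammaMinus_symm p),
      ← inner_conjL2, conjL2_conjL2]
  have e3 : star (Complex.I / 2) * (Complex.I / 2) = (1 / 4 : ℂ) := by
    rw [Complex.star_def, map_div₀, Complex.conj_I, Complex.conj_ofNat]
    linear_combination (-1 / 4) * Complex.I_mul_I
  have key : inner ℂ (bogoliubovSum p f) (bogoliubovSum p g) = (1 / 4 : ℂ) *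
      ((inner ℂ f (multiplier (gammaMinus p) (multiplier (gammaMinus p) g)) + 4 * inner ℂ f g)
       + inner ℂ f (multiplier (gammaMinus p) (multiplier (gammaPlus p) (conjL2 g)))
       + star (inner ℂ f (multiplier (gammaMinus p) (multiplier (gammaPlus p) (conjL2 g))))
       + star (inner ℂ f (multiplier (gammaMinus p) (multiplier (gammaMinus p) g)))) := by
    rw [← e1, ← e2, ← e3, bogoliubovSum, bogoliubovSum, inner_smul_left, inner_smul_right, inner_add_left,
      inner_add_right, inner_add_right, inner_multiplier, inner_multiplier, inner_multiplier,
      inner_multiplier, star_gammaPlus, star_gammaMinus, hs, hc, inner_add_right, inner_smul_right]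
    rw [Complex.star_def]
    ring
  have h4 : (1 / 4 : ℂ) = ((1 / 4 : ℝ) : ℂ) := by push_cast; rfl
  have h5 : (4 * inner ℂ f g : ℂ).im = 4 * (inner ℂ f g).im := by simp
  rw [sigma, key, sigma, h4, Complex.im_ofReal_mul]
  simp only [Complex.add_im, h5, Complex.star_def, Complex.conj_im]
  ring

lemma sigma_phase (t : ℝ) (f g : L2Z) :
    sigma (multiplier (phase p t) f) (multiplier (phase p t) g) = sigma f g := by
  have h : star (phase p t) * phase p t = 1 := by
    ext θ
    simp only [phase, ContinuousMap.mul_apply, ContinuousMap.star_apply, ContinuousMap.coe_mk,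
      ContinuousMap.one_apply, Complex.star_def, ← Complex.exp_conj, map_mul, Complex.conj_I,
      Complex.conj_ofReal, ← Complex.exp_add]
    simp
  rw [sigma, inner_multiplier, multiplier_mul, h, multiplier_one, sigma]

lemma sigma_neg_neg (f g : L2Z) : sigma (-f) (-g) = sigma f g := by simp [sigma]

lemma sigma_evolve (t : ℝ) (f g : L2Z) : sigma (evolve p t f) (evolve p t g) = sigma f g := by
  rw [evolve_apply, evolve_apply, sigma_bogoliubovSum, sigma_phase, sigma_neg_neg, sigma_bogoliubovSum]

lemma evolve_evolve (s t : ℝ) (f : L2Z) : evolve p s (evolve p t f) = evolve p (s + t) f := by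
  have h : phase p s * phase p t = phase p (s + t) := by
    ext θ
    simp only [phase, ContinuousMap.mul_apply, ContinuousMap.coe_mk, ← Complex.exp_add]
    push_cast
    ring_nf
  rw [evolve_apply, evolve_apply, bogoliubovSum_bogoliubovSum, neg_neg, multiplier_mul, h, evolve_apply]

lemma evolve_zero (f : L2Z) : evolve p 0 f = f := by
  have h : phase p 0 = 1 := by ext θ; simp [phase]
  rw [evolve_apply, h, multiplier_one, bogoliubovSum_neg, bogoliubovSum_bogoliubovSum, neg_neg]

/-! ### The Weyl algebra over `ℓ²(ℤ²)` -/

/-- The Hilbert space `ℓ²(ℓ²(ℤ²))` (the index set is discrete) of the regular representation. -/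
abbrev WeylSpace : Type := lp (fun _ : L2Z => ℂ) 2

lemma memlp_twist (e : Equiv.Perm L2Z) (c : L2Z → ℂ) (hc : ∀ h, ‖c h‖ = 1) (ψ : WeylSpace) :
    Memℓp (fun h => c h * ψ (e.symm h)) 2 := by
  have h := (memℓp_gen_iff (p := 2) (by norm_num)).1 (lp.memℓp ψ)
  rw [memℓp_gen_iff (by norm_num)]
  simp only [norm_mul, hc, one_mul]
  exact (e.symm.summable_iff (f := fun h => ‖ψ h‖ ^ (2 : ℝ≥0∞).toReal)).2 h

/-- `(Tψ)(h) = c(h) ψ(e⁻¹ h)`. -/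
def twistLinear (e : Equiv.Perm L2Z) (c : L2Z → ℂ) (hc : ∀ h, ‖c h‖ = 1) :
    WeylSpace →ₗ[ℂ] WeylSpace where
  toFun ψ := ⟨fun h => c h * ψ (e.symm h), memlp_twist e c hc ψ⟩
  map_add' φ ψ := by ext h; exact mul_add _ _ _
  map_smul' a ψ := by ext h; exact mul_left_comm _ _ _

lemma twistLinear_apply (e : Equiv.Perm L2Z) (c : L2Z → ℂ) (hc : ∀ h, ‖c h‖ = 1)
    (ψ : WeylSpace) (h : L2Z) : twistLinear e c hc ψ h = c h * ψ (e.symm h) := rfl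

lemma norm_twistLinear (e : Equiv.Perm L2Z) (c : L2Z → ℂ) (hc : ∀ h, ‖c h‖ = 1)
    (ψ : WeylSpace) : ‖twistLinear e c hc ψ‖ = ‖ψ‖ := by
  rw [lp.norm_eq_tsum_rpow (by norm_num), lp.norm_eq_tsum_rpow (by norm_num)]
  congr 1
  simp only [twistLinear_apply, norm_mul, hc, one_mul]
  exact e.symm.tsum_eq (fun h => ‖ψ h‖ ^ (2 : ℝ≥0∞).toReal)

/-- `twistLinear` as a unitary. -/
def twist (e : Equiv.Perm L2Z) (c : L2Z → ℂ) (hc : ∀ h, ‖c h‖ = 1) :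
    WeylSpace ≃ₗᵢ[ℂ] WeylSpace :=
  LinearIsometryEquiv.ofSurjective ⟨twistLinear e c hc, norm_twistLinear e c hc⟩ fun ψ => by
    refine ⟨twistLinear e.symm (fun h => (c (e h))⁻¹) (fun h => by simp [hc]) ψ, ?_⟩
    ext h
    have h0 : c h ≠ 0 := by rw [← norm_ne_zero_iff, hc]; norm_num
    change c h * ((c (e (e.symm h)))⁻¹ * ψ (e.symm.symm (e.symm h))) = ψ h
    simp [h0]

lemma twist_apply (e : Equiv.Perm L2Z) (c : L2Z → ℂ) (hc : ∀ h, ‖c h‖ = 1)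
    (ψ : WeylSpace) (h : L2Z) : twist e c hc ψ h = c h * ψ (e.symm h) := rfl

lemma norm_weylPhase (f h : L2Z) : ‖Complex.exp (-(Complex.I * sigma f h) / 2)‖ = 1 := by
  rw [Complex.norm_exp]
  simp

/-- The Weyl unitary `(W(f)ψ)(h) = e^{-iσ(f,h)/2} ψ(h - f)`. -/
def weylUnitary (f : L2Z) : unitary (WeylSpace →L[ℂ] WeylSpace) :=
  Unitary.linearIsometryEquiv.symm
    (twist (Equiv.addLeft f) (fun h => Complex.exp (-(Complex.I * sigma f h) / 2))
      (norm_weylPhase f))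

lemma weylUnitary_apply (f : L2Z) (ψ : WeylSpace) (h : L2Z) :
    (weylUnitary f : WeylSpace →L[ℂ] WeylSpace) ψ h
      = Complex.exp (-(Complex.I * sigma f h) / 2) * ψ (-f + h) := rfl

/-- The Weyl algebra `𝓦(ℓ²(ℤ²))`: the C*-algebra generated by the Weyl unitaries. -/
def WeylAlgebra : StarSubalgebra ℂ (WeylSpace →L[ℂ] WeylSpace) :=
  (StarAlgebra.adjoin ℂ
    (Set.range fun f : L2Z => (weylUnitary f : WeylSpace →L[ℂ] WeylSpace))).topologicalClosure

lemma weylUnitary_mem (f : L2Z) : (weylUnitary f : WeylSpace →L[ℂ] WeylSpace) ∈ WeylAlgebra :=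
  StarSubalgebra.le_topologicalClosure _ (StarAlgebra.subset_adjoin ℂ _ ⟨f, rfl⟩)

/-- The Weyl operators as elements of the Weyl algebra. -/
def W (f : L2Z) : WeylAlgebra := ⟨weylUnitary f, weylUnitary_mem f⟩

lemma sigma_add_left (f g h : L2Z) : sigma (f + g) h = sigma f h + sigma g h := by
  simp [sigma]

lemma sigma_add_right (f g h : L2Z) : sigma f (g + h) = sigma f g + sigma f h := by
  simp [sigma]

lemma sigma_neg_right (f g : L2Z) : sigma f (-g) = -sigma f g := by simp [sigma]

lemma sigma_neg_left (f g : L2Z) : sigma (-f) g = -sigma f g := by simp [sigma]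

lemma sigma_self (f : L2Z) : sigma f f = 0 := by
  exact inner_self_im (𝕜 := ℂ) f

/-- The Weyl relations. -/
theorem W_mul_W (f g : L2Z) :
    W f * W g = Complex.exp (-(Complex.I * sigma f g) / 2) • W (f + g) := by
  apply Subtype.ext
  apply ContinuousLinearMap.ext
  intro ψ
  ext h
  change Complex.exp (-(Complex.I * sigma f h) / 2)
      * (Complex.exp (-(Complex.I * sigma g (-f + h)) / 2) * ψ (-g + (-f + h)))
    = Complex.exp (-(Complex.I * sigma f g) / 2)
      * (Complex.exp (-(Complex.I * sigma (f + g) h) / 2) * ψ (-(f + g) + h))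
  have h1 : -g + (-f + h) = -(f + g) + h := by abel
  have h2 : sigma g f = -sigma f g := by
    have := sigma_self (f + g)
    rw [sigma_add_left, sigma_add_right, sigma_add_right, sigma_self, sigma_self] at this
    linarith
  rw [h1, ← mul_assoc, ← mul_assoc, ← Complex.exp_add, ← Complex.exp_add, sigma_add_right,
    sigma_neg_right, sigma_add_left, h2]
  push_cast
  ring_nf

theorem W_zero : W 0 = 1 := by
  apply Subtype.ext
  apply ContinuousLinearMap.ext
  intro ψ
  ext h
  change Complex.exp (-(Complex.I * sigma 0 h) / 2) * ψ (-0 + h) = ψ h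
  simp [sigma]

theorem star_W (f : L2Z) : star (W f) = W (-f) := by
  have h1 : star (W f) * W f = 1 := by
    apply Subtype.ext
    exact Unitary.coe_star_mul_self (weylUnitary f)
  have h2 : W f * W (-f) = 1 := by
    rw [W_mul_W, sigma_neg_right, sigma_self, add_neg_cancel, W_zero]; simp
  calc star (W f) = star (W f) * (W f * W (-f)) := by rw [h2, mul_one]
    _ = W (-f) := by rw [← mul_assoc, h1, one_mul]

/-! ### The harmonic dynamics -/

/-- The unitary `ψ ↦ ψ ∘ e⁻¹`. -/
def transport (e : Equiv.Perm L2Z) : unitary (WeylSpace →L[ℂ] WeylSpace) :=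
  Unitary.linearIsometryEquiv.symm (twist e (fun _ => 1) (fun _ => by simp))

lemma transport_conj (e : Equiv.Perm L2Z) (hadd : ∀ f g, e (f + g) = e f + e g)
    (hσ : ∀ f g, sigma (e f) (e g) = sigma f g) (f : L2Z) :
    Unitary.conjStarAlgAut ℂ _ (transport e) (weylUnitary f : WeylSpace →L[ℂ] WeylSpace)
      = weylUnitary (e f) := by
  rw [Unitary.conjStarAlgAut_apply]
  have h : (transport e : WeylSpace →L[ℂ] WeylSpace) * weylUnitary f
      = (weylUnitary (e f) : WeylSpace →L[ℂ] WeylSpace) * transport e := by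
    apply ContinuousLinearMap.ext
    intro ψ
    ext h
    change 1 * (Complex.exp (-(Complex.I * sigma f (e.symm h)) / 2) * ψ (-f + e.symm h))
      = Complex.exp (-(Complex.I * sigma (e f) h) / 2) * (1 * ψ (e.symm (-(e f) + h)))
    have h1 : sigma f (e.symm h) = sigma (e f) h := by rw [← hσ]; simp
    have h2 : e.symm (-(e f) + h) = -f + e.symm h := by
      rw [Equiv.symm_apply_eq]
      have h3 := hadd f (-f + e.symm h)
      rw [add_neg_cancel_left, Equiv.apply_symm_apply] at h3
      calc -(e f) + h = -(e f) + (e f + e (-f + e.symm h)) := by rw [← h3]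
        _ = e (-f + e.symm h) := neg_add_cancel_left _ _
    rw [h1, h2, one_mul, one_mul]
  rw [h, mul_assoc, ← Unitary.coe_star, Unitary.coe_mul_star_self, mul_one]

lemma conj_mem (e : Equiv.Perm L2Z) (hadd : ∀ f g, e (f + g) = e f + e g)
    (hσ : ∀ f g, sigma (e f) (e g) = sigma f g) {a : WeylSpace →L[ℂ] WeylSpace}
    (ha : a ∈ WeylAlgebra) : Unitary.conjStarAlgAut ℂ _ (transport e) a ∈ WeylAlgebra := by
  set Φ := (Unitary.conjStarAlgAut ℂ (WeylSpace →L[ℂ] WeylSpace) (transport e) :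
    (WeylSpace →L[ℂ] WeylSpace) →⋆ₐ[ℂ] (WeylSpace →L[ℂ] WeylSpace)) with hΦ
  have hcont : Continuous Φ := by
    change Continuous fun a => (transport e : WeylSpace →L[ℂ] WeylSpace) * a
      * (star (transport e) : WeylSpace →L[ℂ] WeylSpace)
    fun_prop
  have hle : WeylAlgebra ≤ WeylAlgebra.comap Φ := by
    apply StarSubalgebra.topologicalClosure_minimal
    · apply StarAlgebra.adjoin_le
      rintro _ ⟨f, rfl⟩
      change Unitary.conjStarAlgAut ℂ _ (transport e)
        (weylUnitary f : WeylSpace →L[ℂ] WeylSpace) ∈ WeylAlgebra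
      rw [transport_conj e hadd hσ]
      exact weylUnitary_mem _
    · exact (StarSubalgebra.isClosed_topologicalClosure _).preimage hcont
  exact hle ha

lemma transport_symm (e : Equiv.Perm L2Z) : transport e.symm = star (transport e) := by
  rw [Unitary.star_eq_inv, eq_inv_iff_mul_eq_one]
  apply Subtype.ext
  apply ContinuousLinearMap.ext
  intro ψ
  ext h
  change 1 * (1 * ψ (e.symm (e.symm.symm h))) = ψ h
  simp

/-- `T_t` is a bijection with inverse `T_{-t}`. -/
def evolveEquiv (t : ℝ) : Equiv.Perm L2Z where
  toFun := evolve p t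
  invFun := evolve p (-t)
  left_inv f := by rw [evolve_evolve, neg_add_cancel, evolve_zero]
  right_inv f := by rw [evolve_evolve, add_neg_cancel, evolve_zero]

lemma conj_mem_evolve (t : ℝ) {a : WeylSpace →L[ℂ] WeylSpace} (ha : a ∈ WeylAlgebra) :
    Unitary.conjStarAlgAut ℂ _ (transport (evolveEquiv p t)) a ∈ WeylAlgebra :=
  conj_mem _ (fun f g => map_add (evolve p t) f g) (fun f g => sigma_evolve p t f g) ha

/-- The harmonic dynamics `τ_t`, the *-automorphism of the Weyl algebra with
`τ_t(W(f)) = W(T_t f)`; it is implemented by the unitary `δ_h ↦ δ_{T_t h}`. -/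
def dynamics (t : ℝ) : WeylAlgebra ≃⋆ₐ[ℂ] WeylAlgebra where
  toFun a := ⟨Unitary.conjStarAlgAut ℂ _ (transport (evolveEquiv p t)) a,
    conj_mem_evolve p t a.2⟩
  invFun a := ⟨(Unitary.conjStarAlgAut ℂ _ (transport (evolveEquiv p t))).symm a, by
    have h := conj_mem_evolve p (-t) a.2
    have h2 : transport (evolveEquiv p (-t)) = star (transport (evolveEquiv p t)) := by
      rw [← transport_symm]
      refine congrArg transport (Equiv.ext fun f => ?_)
      change evolve p (-t) f = evolve p (-t) f
      rfl
    rw [h2, Unitary.conjStarAlgAut_apply] at h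
    rw [Unitary.conjStarAlgAut_symm_apply]
    simpa using h⟩
  left_inv a := Subtype.ext (StarAlgEquiv.symm_apply_apply _ _)
  right_inv a := Subtype.ext (StarAlgEquiv.apply_symm_apply _ _)
  map_mul' a b := Subtype.ext (map_mul (Unitary.conjStarAlgAut ℂ _ _) _ _)
  map_add' a b := Subtype.ext (map_add (Unitary.conjStarAlgAut ℂ _ _) _ _)
  map_star' a := Subtype.ext (map_star (Unitary.conjStarAlgAut ℂ _ _) _)
  map_smul' c a := Subtype.ext (map_smul (Unitary.conjStarAlgAut ℂ _ _) c _)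

theorem dynamics_W (t : ℝ) (f : L2Z) : dynamics p t (W f) = W (evolve p t f) :=
  Subtype.ext (transport_conj _ (fun f g => map_add (evolve p t) f g)
    (fun f g => sigma_evolve p t f g) f)

/-- The embedding `ℓ¹(ℤ²) ⊆ ℓ²(ℤ²)`. -/
def ofL1 (f : lp (fun _ : Z2 => ℂ) 1) : L2Z :=
  (⟨f, (lp.memℓp f).of_exponent_ge (by norm_num)⟩ : lp (fun _ : Z2 => ℂ) 2)

/-- The commutator norm `‖[τ_t(W(f)), W(g)]‖` for `f, g ∈ ℓ¹(ℤ²)`. -/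
def commNorm (t : ℝ) (f g : lp (fun _ : Z2 => ℂ) 1) : ℝ :=
  ‖dynamics p t (W (ofL1 f)) * W (ofL1 g) - W (ofL1 g) * dynamics p t (W (ofL1 f))‖

/-- The support of a function on the lattice. -/
abbrev supp (f : lp (fun _ : Z2 => ℂ) 1) : Set Z2 := Function.support (f : Z2 → ℂ)

end

end HarmonicLattice

open HarmonicLattice

namespace HarmonicLattice

noncomputable section

/-! ### Reduction of the commutator to the symplectic form -/

/-! By the Weyl relations `W f * W g` and `W g * W f` differ by a phase only, so the commutator is
bounded by |σ(T_t f, g)|. This form is real bilinear; for f, g ∈ ℓ¹ it suffices to bound it at point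
masses. There it is a combination of the Fourier coefficients at n = y - x of cos γt, γ⁻¹ sin γt and
γ sin γt (`evolve_eq`, `sigma_evolve_delta`).

These three functions are entire functions of γ², and γ² is a trigonometric polynomial. Shifting k
to k - iη therefore needs neither a branch of the square root nor a contour integral: it multiplies
the n-th coefficient by e^{η·n}, and this is compatible with power series in γ² (`IsShift`). Hence a
coefficient is at most e^{-η·n} times the supremum of the shifted function, which grows no faster
than e^{|t| |Im w|}, up to a factor at most linear in |t|, where w² is the shifted γ².

For the light cone bound, η is parallel to n with length μ (zero if n = 0), and half-angle formulas
bound |Im w| uniformly (`sq_bounds_of_sq_eq_gammaSq`).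

For the bound outside the range of velocities, the shift is ε times a direction u with ε small. Then
|Im w| ≤ ε|u·∇γ(k)| + O(ε²) (`exists_abs_im_le`), and the exponent becomes -ε(u·(x - y) - |t|
sup|u·∇γ|) + O(ε²|t|). If the set of group velocities is convex, some u makes the bracket at least
the distance from x - y to t∇γ([-π,π]²). Convexity is `convex_image_velocity`. This distance is also
the one to tV₁, because V₁ is dense in the set of group velocities (`velocity_mem_closure_V1`). The
error O(ε²|t|) is absorbed by dist ≥ δ|t| once ε is small compared with δ. -/

lemma norm_W_le (f : L2Z) : ‖W f‖ ≤ 1 := by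
  change ‖(weylUnitary f : WeylSpace →L[ℂ] WeylSpace)‖ ≤ 1
  refine ContinuousLinearMap.opNorm_le_bound _ zero_le_one fun ψ => ?_
  rw [one_mul]
  exact ((twist (Equiv.addLeft f) (fun h => Complex.exp (-(Complex.I * sigma f h) / 2))
    (norm_weylPhase f)).norm_map ψ).le

lemma sigma_swap (f g : L2Z) : sigma g f = -sigma f g := by
  have := sigma_self (f + g)
  rw [sigma_add_left, sigma_add_right, sigma_add_right, sigma_self, sigma_self] at this
  linarith

/-- Both products are multiples of the same `W (f + g)` with conjugate phases, whose difference is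
-2i sin(σ/2). -/
lemma norm_W_commutator_le (f g : L2Z) : ‖W f * W g - W g * W f‖ ≤ |sigma f g| := by
  rw [W_mul_W f g, W_mul_W g f, add_comm g f, sigma_swap f g, ← sub_smul]
  have h : Complex.exp (-(Complex.I * sigma f g) / 2)
      - Complex.exp (-(Complex.I * (-sigma f g : ℝ)) / 2)
      = ((-2 * Real.sin (sigma f g / 2) : ℝ) : ℂ) * Complex.I := by
    have e1 : -(Complex.I * (sigma f g : ℂ)) / 2
        = ((-(sigma f g / 2) : ℝ) : ℂ) * Complex.I := by push_cast; ring
    have e2 : -(Complex.I * ((-sigma f g : ℝ) : ℂ)) / 2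
        = ((sigma f g / 2 : ℝ) : ℂ) * Complex.I := by push_cast; ring
    rw [e1, e2, Complex.exp_mul_I, Complex.exp_mul_I]
    push_cast
    rw [Complex.cos_neg, Complex.sin_neg]
    ring
  rw [h]
  refine (norm_smul_le _ _).trans ?_
  rw [norm_mul, Complex.norm_I, mul_one, Complex.norm_real, Real.norm_eq_abs, abs_mul]
  have h1 : |Real.sin (sigma f g / 2)| ≤ |sigma f g| / 2 := by
    refine Real.abs_sin_le_abs.trans ?_
    rw [abs_div, abs_two]
  have h2 := norm_W_le (f + g)
  have h3 := abs_nonneg (sigma f g)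
  have h4 : |(-2 : ℝ)| = 2 := by norm_num
  rw [h4]
  calc 2 * |Real.sin (sigma f g / 2)| * ‖W (f + g)‖
      ≤ 2 * (|sigma f g| / 2) * 1 := by gcongr
    _ = |sigma f g| := by ring

lemma commNorm_le (p : Params) (t : ℝ) (f g : lp (fun _ : Z2 => ℂ) 1) :
    commNorm p t f g ≤ |sigma (evolve p t (ofL1 f)) (ofL1 g)| := by
  rw [commNorm, dynamics_W]
  exact norm_W_commutator_le _ _

/-! ### The evolution in terms of even functions of `γ` -/

variable (p : Params)

/-- `cos (γ t)` on the torus. -/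
def cosMul (t : ℝ) : C(UnitAddTorus (Fin 2), ℂ) where
  toFun θ := ((Real.cos (gammaTorus p θ * t) : ℝ) : ℂ)
  continuous_toFun := by
    have h := continuous_gammaTorus p
    fun_prop

/-- `γ sin (γ t)` on the torus. -/
def mulSinMul (t : ℝ) : C(UnitAddTorus (Fin 2), ℂ) where
  toFun θ := ((gammaTorus p θ * Real.sin (gammaTorus p θ * t) : ℝ) : ℂ)
  continuous_toFun := by
    have h := continuous_gammaTorus p
    fun_prop

/-- `γ⁻¹ sin (γ t)` on the torus. -/
def divSinMul (t : ℝ) : C(UnitAddTorus (Fin 2), ℂ) where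
  toFun θ := (((gammaTorus p θ)⁻¹ * Real.sin (gammaTorus p θ * t) : ℝ) : ℂ)
  continuous_toFun := by
    have h := continuous_gammaTorus p
    exact Complex.continuous_ofReal.comp ((h.inv₀ fun θ => (gammaTorus_pos p θ).ne').mul
      (Real.continuous_sin.comp (h.mul continuous_const)))

lemma multiplier_add (φ ψ : C(UnitAddTorus (Fin 2), ℂ)) (f : L2Z) :
    multiplier (φ + ψ) f = multiplier φ f + multiplier ψ f := by
  simp [multiplier, mulOp]

lemma multiplier_sub (φ ψ : C(UnitAddTorus (Fin 2), ℂ)) (f : L2Z) :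
    multiplier (φ - ψ) f = multiplier φ f - multiplier ψ f := by
  simp [multiplier, mulOp]

lemma multiplier_smul (c : ℂ) (φ : C(UnitAddTorus (Fin 2), ℂ)) (f : L2Z) :
    multiplier (c • φ) f = c • multiplier φ f := by
  simp [multiplier, mulOp]

/-- Since γ is even, conjugation in position space reverses the time in e^{iγt}. -/
lemma multiplier_phase_conj (t : ℝ) (f : L2Z) :
    conjL2 (multiplier (phase p t) f) = multiplier (star (phase p t)) (conjL2 f) := by
  symm
  apply fourierTransform_symm_conj
  have h2 := measurePreserving_neg_torus.quasiMeasurePreserving.ae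
    (coeFn_mulOp (phase p t) (fourierTransform f))
  filter_upwards [coeFn_mulOp (star (phase p t)) (fourierTransform (conjL2 f)),
    coeFn_fourierTransform_conj f, h2] with θ a b c
  change (mulOp (star (phase p t)) (fourierTransform (conjL2 f))) θ
    = star ((mulOp (phase p t) (fourierTransform f)) (-θ))
  rw [a, b, c, star_mul']
  congr 1
  simp [phase, gammaTorus_neg]

lemma evolve_eq_phase (t : ℝ) (f : L2Z) : evolve p t f
    = multiplier ((1 / 4 : ℂ) • (gammaPlus p * gammaPlus p * phase p t
        - gammaMinus p * gammaMinus p * star (phase p t))) f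
      + multiplier ((1 / 4 : ℂ) • (gammaPlus p * gammaMinus p * phase p t
        - gammaPlus p * gammaMinus p * star (phase p t))) (conjL2 f) := by
  have hI : Complex.I * Complex.I = -1 := Complex.I_mul_I
  have hs : star (Complex.I / 2) = -(Complex.I / 2) := by simp [neg_div]
  rw [evolve_apply]
  unfold bogoliubovSum
  simp only [map_neg, map_smul, map_add, conjL2_smul, multiplier_phase_conj, hs,
    ← multiplier_conj _ (gammaPlus_symm p), ← multiplier_conj _ (gammaMinus_symm p), conjL2_conjL2]
  simp only [multiplier_mul, multiplier_sub, multiplier_smul]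
  have e2 : gammaMinus p * (star (phase p t) * gammaPlus p)
      = gammaPlus p * gammaMinus p * star (phase p t) := by ring
  have e3 : gammaMinus p * (star (phase p t) * gammaMinus p)
      = gammaMinus p * gammaMinus p * star (phase p t) := by ring
  have e4 : gammaPlus p * (phase p t * gammaMinus p)
      = gammaPlus p * gammaMinus p * phase p t := by ring
  have e5 : gammaPlus p * (phase p t * gammaPlus p)
      = gammaPlus p * gammaPlus p * phase p t := by ring
  rw [e2, e3, e4, e5]
  match_scalars <;> first | linear_combination (1 / 4) * hI | linear_combination (-1 / 4) * hI

/-- The square roots of γ in Γ₊ and Γ₋ occur only in products of two, and what remains is even in γ.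
This is what later allows complex momenta, where γ itself has branch points. -/
lemma evolve_eq (t : ℝ) (f : L2Z) : evolve p t f
    = multiplier (cosMul p t) f + (Complex.I / 2) • multiplier (divSinMul p t) (f + conjL2 f)
      + (Complex.I / 2) • multiplier (mulSinMul p t) (f - conjL2 f) := by
  rw [evolve_eq_phase]
  have key : ∀ θ, ((√(gammaTorus p θ) : ℝ) : ℂ) ≠ 0 ∧
      ((gammaTorus p θ : ℝ) : ℂ) = ((√(gammaTorus p θ) : ℝ) : ℂ) ^ 2 := fun θ =>
    ⟨Complex.ofReal_ne_zero.2 (Real.sqrt_pos.2 (gammaTorus_pos p θ)).ne', by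
      rw [← Complex.ofReal_pow, Real.sq_sqrt (gammaTorus_pos p θ).le]⟩
  have hph : ∀ θ, phase p t θ = (Real.cos (gammaTorus p θ * t) : ℂ)
      + (Real.sin (gammaTorus p θ * t) : ℂ) * Complex.I := fun θ => by
    change Complex.exp _ = _
    rw [show Complex.I * (gammaTorus p θ : ℂ) * t
      = ((gammaTorus p θ * t : ℝ) : ℂ) * Complex.I by push_cast; ring, Complex.exp_mul_I]
    push_cast; rfl
  have hph' : ∀ θ, star (phase p t) θ = (Real.cos (gammaTorus p θ * t) : ℂ)
      - (Real.sin (gammaTorus p θ * t) : ℂ) * Complex.I := fun θ => by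
    rw [ContinuousMap.star_apply, hph]
    simp only [star_add, star_mul', Complex.star_def, Complex.conj_ofReal, Complex.conj_I]
    ring
  have h1 : (1 / 4 : ℂ) • (gammaPlus p * gammaPlus p * phase p t
        - gammaMinus p * gammaMinus p * star (phase p t))
      = cosMul p t + (Complex.I / 2) • divSinMul p t + (Complex.I / 2) • mulSinMul p t := by
    ext θ
    simp only [ContinuousMap.smul_apply, ContinuousMap.sub_apply, ContinuousMap.mul_apply,
      ContinuousMap.add_apply, hph, hph', smul_eq_mul, gammaPlus, gammaMinus, cosMul, divSinMul,
      mulSinMul, ContinuousMap.coe_mk]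
    obtain ⟨h0, hsq⟩ := key θ
    push_cast
    rw [hsq]
    field_simp
    ring
  have h2 : (1 / 4 : ℂ) • (gammaPlus p * gammaMinus p * phase p t
        - gammaPlus p * gammaMinus p * star (phase p t))
      = (Complex.I / 2) • divSinMul p t - (Complex.I / 2) • mulSinMul p t := by
    ext θ
    simp only [ContinuousMap.smul_apply, ContinuousMap.sub_apply, ContinuousMap.mul_apply,
      hph, hph', smul_eq_mul, gammaPlus, gammaMinus, divSinMul,
      mulSinMul, ContinuousMap.coe_mk]
    obtain ⟨h0, hsq⟩ := key θ
    push_cast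
    rw [hsq]
    field_simp
    ring
  rw [h1, h2]
  simp only [multiplier_add, multiplier_sub, multiplier_smul, map_add, map_sub]
  module

/-! ### Matrix elements -/

/-- The vector `a δₓ`. -/
def delta (x : Z2) (a : ℂ) : L2Z := (lp.single 2 x a : lp (fun _ : Z2 => ℂ) 2)

lemma conjL2_delta (x : Z2) (a : ℂ) : conjL2 (delta x a) = delta x (star a) := by
  refine L2Z.ext fun y => ?_
  rw [conjL2_apply]
  change star ((lp.single 2 x a : lp (fun _ : Z2 => ℂ) 2) y)
    = (lp.single 2 x (star a) : lp (fun _ : Z2 => ℂ) 2) y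
  by_cases h : y = x
  · subst h; simp
  · rw [lp.single_apply_ne _ _ _ h, lp.single_apply_ne _ _ _ h, star_zero]

lemma inner_delta (f : L2Z) (y : Z2) (b : ℂ) : inner ℂ f (delta y b) = star (f y) * b := by
  have h := lp.inner_single_right (𝕜 := ℂ) y b f
  rw [RCLike.inner_apply, mul_comm] at h
  exact h

lemma delta_add (x : Z2) (a b : ℂ) : delta x (a + b) = delta x a + delta x b :=
  lp.single_add (E := fun _ : Z2 => ℂ) 2 x a b

lemma delta_sub (x : Z2) (a b : ℂ) : delta x (a - b) = delta x a - delta x b :=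
  lp.single_sub (E := fun _ : Z2 => ℂ) 2 x a b

lemma delta_eq_smul (x : Z2) (a : ℂ) : delta x a = a • delta x 1 := by
  have := lp.single_smul (E := fun _ : Z2 => ℂ) 2 x a (1 : ℂ)
  rw [smul_eq_mul, mul_one] at this
  exact this

lemma multiplier_delta (φ : C(UnitAddTorus (Fin 2), ℂ)) (x y : Z2) (a : ℂ) :
    multiplier φ (delta x a) y = a * UnitAddTorus.mFourierCoeff φ (y - x) := by
  have h1 : fourierTransform (delta x 1) = UnitAddTorus.mFourierLp 2 x := by
    rw [← UnitAddTorus.coe_mFourierBasis]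
    exact UnitAddTorus.mFourierBasis.repr_symm_single x
  have h2 : multiplier φ (delta x 1) y = UnitAddTorus.mFourierCoeff φ (y - x) := by
    change fourierTransform.symm (mulOp φ (fourierTransform (delta x 1))) y = _
    rw [fourierTransform_symm_apply, h1]
    unfold UnitAddTorus.mFourierCoeff
    refine integral_congr_ae ?_
    filter_upwards [coeFn_mulOp φ (UnitAddTorus.mFourierLp 2 x),
      UnitAddTorus.coeFn_mFourierLp 2 x] with θ h3 h4
    refine (congrArg _ (h3.trans (congrArg _ h4))).trans ?_
    rw [smul_eq_mul, show -(y - x) = -y + x by abel, UnitAddTorus.mFourier_add]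
    ring
  rw [delta_eq_smul, map_smul, ← h2]
  rfl

/-- Such a multiplier commutes with complex conjugation, so its convolution kernel is real. -/
lemma mFourierCoeff_im {φ : C(UnitAddTorus (Fin 2), ℂ)} (hφ : ∀ θ, star (φ (-θ)) = φ θ) (n : Z2) :
    (UnitAddTorus.mFourierCoeff φ n).im = 0 := by
  have h := multiplier_conj φ hφ (delta 0 1)
  rw [conjL2_delta, star_one] at h
  have h2 := congrArg (fun f : L2Z => f n) h
  simp only [conjL2_apply, multiplier_delta, sub_zero, one_mul] at h2
  have := congrArg Complex.im h2
  simp at this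
  linarith

lemma sigma_evolve_delta (t : ℝ) (x y : Z2) (a b : ℂ) :
    sigma (evolve p t (delta x a)) (delta y b)
      = (UnitAddTorus.mFourierCoeff (cosMul p t) (y - x)).re * (a.re * b.im - a.im * b.re)
        - (UnitAddTorus.mFourierCoeff (divSinMul p t) (y - x)).re * (a.re * b.re)
        - (UnitAddTorus.mFourierCoeff (mulSinMul p t) (y - x)).re * (a.im * b.im) := by
  have hc : ∀ θ, star (cosMul p t (-θ)) = cosMul p t θ := fun θ => by
    simp only [cosMul, ContinuousMap.coe_mk, gammaTorus_neg, Complex.star_def, Complex.conj_ofReal]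
  have hs : ∀ θ, star (divSinMul p t (-θ)) = divSinMul p t θ := fun θ => by
    simp only [divSinMul, ContinuousMap.coe_mk, gammaTorus_neg, Complex.star_def,
      Complex.conj_ofReal]
  have hg : ∀ θ, star (mulSinMul p t (-θ)) = mulSinMul p t θ := fun θ => by
    simp only [mulSinMul, ContinuousMap.coe_mk, gammaTorus_neg, Complex.star_def,
      Complex.conj_ofReal]
  have ic := mFourierCoeff_im hc (y - x)
  have is := mFourierCoeff_im hs (y - x)
  have ig := mFourierCoeff_im hg (y - x)
  rw [evolve_eq, conjL2_delta, ← delta_add, ← delta_sub, sigma, inner_add_left, inner_add_left,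
    inner_smul_left, inner_smul_left, inner_delta, inner_delta, inner_delta, multiplier_delta,
    multiplier_delta, multiplier_delta]
  simp only [Complex.add_im, Complex.mul_im, Complex.mul_re, Complex.star_def, Complex.conj_re,
    Complex.conj_im, Complex.add_re, Complex.sub_re, Complex.sub_im, ic, is, ig, map_div₀,
    Complex.conj_I, Complex.conj_ofNat, Complex.div_ofNat_re, Complex.div_ofNat_im, Complex.neg_re,
    Complex.neg_im, Complex.I_re, Complex.I_im]
  ring

/-- The cosine coefficient pairs real with imaginary parts; the other two pair real with real and
imaginary with imaginary. By Cauchy–Schwarz each of the two kinds of pairing is at most ‖a‖‖b‖, so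
the sine coefficients enter through their maximum and not their sum. The constant max{1, C} of the
theorem depends on this. -/
lemma abs_sigma_evolve_delta_le {t K : ℝ} {x y : Z2}
    (hs : ‖UnitAddTorus.mFourierCoeff (divSinMul p t) (y - x)‖
      + ‖UnitAddTorus.mFourierCoeff (cosMul p t) (y - x)‖ ≤ K)
    (hg : ‖UnitAddTorus.mFourierCoeff (mulSinMul p t) (y - x)‖
      + ‖UnitAddTorus.mFourierCoeff (cosMul p t) (y - x)‖ ≤ K) (a b : ℂ) :
    |sigma (evolve p t (delta x a)) (delta y b)| ≤ K * ‖a‖ * ‖b‖ := by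
  rw [sigma_evolve_delta]
  set C := (UnitAddTorus.mFourierCoeff (cosMul p t) (y - x)).re with hC
  set A := (UnitAddTorus.mFourierCoeff (divSinMul p t) (y - x)).re
  set B := (UnitAddTorus.mFourierCoeff (mulSinMul p t) (y - x)).re
  have hA : |A| + |C| ≤ K := (add_le_add (Complex.abs_re_le_norm _)
    (Complex.abs_re_le_norm _)).trans hs
  have hB : |B| + |C| ≤ K := (add_le_add (Complex.abs_re_le_norm _)
    (Complex.abs_re_le_norm _)).trans hg
  have h1 : ‖a‖ * ‖b‖ = √((a.re ^ 2 + a.im ^ 2) * (b.re ^ 2 + b.im ^ 2)) := by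
    rw [← norm_mul, Complex.norm_def, map_mul, Complex.normSq_apply, Complex.normSq_apply]
    ring_nf
  have h2 : |C * (a.re * b.im - a.im * b.re)| ≤ |C| * (|a.re| * |b.im| + |a.im| * |b.re|) := by
    rw [abs_mul]
    refine mul_le_mul_of_nonneg_left ?_ (abs_nonneg _)
    rw [← abs_mul, ← abs_mul]
    exact abs_sub _ _
  have h3 : |A * (a.re * b.re)| = |A| * (|a.re| * |b.re|) := by rw [abs_mul, abs_mul]
  have h4 : |B * (a.im * b.im)| = |B| * (|a.im| * |b.im|) := by rw [abs_mul, abs_mul]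
  have h5 : |C * (a.re * b.im - a.im * b.re) - A * (a.re * b.re) - B * (a.im * b.im)|
      ≤ |C * (a.re * b.im - a.im * b.re)| + |A * (a.re * b.re)| + |B * (a.im * b.im)| :=
    (abs_sub _ _).trans (add_le_add_left (abs_sub _ _) _)
  have hsq : ∀ r s : ℝ, 0 ≤ r → r ^ 2 ≤ s → r ≤ √s := fun r s _ h => Real.le_sqrt_of_sq_le h
  rw [← sq_abs a.re, ← sq_abs a.im, ← sq_abs b.re, ← sq_abs b.im] at h1
  set α := |a.re|
  set β := |a.im|
  set α' := |b.re|
  set β' := |b.im|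
  have hα : 0 ≤ α := abs_nonneg _
  have hβ : 0 ≤ β := abs_nonneg _
  have hα' : 0 ≤ α' := abs_nonneg _
  have hβ' : 0 ≤ β' := abs_nonneg _
  have h6 : α * α' + β * β' ≤ ‖a‖ * ‖b‖ := by
    rw [h1]
    exact hsq _ _ (by positivity) (by nlinarith [sq_nonneg (α * β' - β * α')])
  have h7 : α * β' + β * α' ≤ ‖a‖ * ‖b‖ := by
    rw [h1]
    exact hsq _ _ (by positivity) (by nlinarith [sq_nonneg (α * α' - β * β')])
  have h8 : 0 ≤ K - |C| := by linarith [abs_nonneg A]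
  calc _ ≤ |C| * (α * β' + β * α') + |A| * (α * α') + |B| * (β * β') := by linarith
    _ ≤ |C| * (α * β' + β * α') + (K - |C|) * (α * α') + (K - |C|) * (β * β') := by
        gcongr <;> linarith
    _ = |C| * (α * β' + β * α') + (K - |C|) * (α * α' + β * β') := by ring
    _ ≤ |C| * (‖a‖ * ‖b‖) + (K - |C|) * (‖a‖ * ‖b‖) := by gcongr
    _ = K * ‖a‖ * ‖b‖ := by ring

/-! ### Summation over `ℓ¹` -/

lemma summable_norm_lp_one (f : lp (fun _ : Z2 => ℂ) 1) : Summable fun x => ‖f x‖ := by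
  have h := (memℓp_gen_iff (p := 1) (by norm_num)).1 (lp.memℓp f)
  simpa using h

lemma norm_lp_one (f : lp (fun _ : Z2 => ℂ) 1) : ‖f‖ = ∑' x, ‖f x‖ := by
  rw [lp.norm_eq_tsum_rpow (by norm_num)]
  simp

lemma hasSum_delta (f : L2Z) : HasSum (fun x => delta x (f x)) f :=
  lp.hasSum_single (by norm_num) (show lp (fun _ : Z2 => ℂ) 2 from f)

/-- The expansion into point masses converges in ℓ², where `Λ` is continuous, while the bounds on
its terms sum to the ℓ¹ norm. -/
lemma abs_apply_ofL1_le (Λ : L2Z →L[ℝ] ℝ) {K : ℝ} (f : lp (fun _ : Z2 => ℂ) 1)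
    (h : ∀ x ∈ supp f, |Λ (delta x (f x))| ≤ K * ‖f x‖) : |Λ (ofL1 f)| ≤ K * ‖f‖ := by
  have h1 : HasSum (fun x => Λ (delta x (f x))) (Λ (ofL1 f)) := (hasSum_delta (ofL1 f)).mapL Λ
  have h2 : ∀ x, ‖Λ (delta x (f x))‖ ≤ K * ‖f x‖ := fun x => by
    by_cases hx : x ∈ supp f
    · exact h x hx
    · rw [Function.notMem_support] at hx
      rw [hx, delta_eq_smul, zero_smul, map_zero]
      simp
  rw [← h1.tsum_eq, norm_lp_one, ← tsum_mul_left, ← Real.norm_eq_abs]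
  exact tsum_of_norm_bounded ((summable_norm_lp_one f).mul_left K).hasSum h2

/-- `f ↦ σ(f, g)` as a continuous real-linear functional. -/
def sigmaLeft (g : L2Z) : L2Z →L[ℝ] ℝ :=
  -(Complex.imCLM ∘L (innerSL ℂ g).restrictScalars ℝ)

lemma sigmaLeft_apply (g f : L2Z) : sigmaLeft g f = sigma f g := by
  change -(sigma g f) = sigma f g
  rw [sigma_swap, neg_neg]

lemma commNorm_le_of_coeff {t K : ℝ} {f g : lp (fun _ : Z2 => ℂ) 1}
    (h : ∀ x ∈ supp f, ∀ y ∈ supp g,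
      ‖UnitAddTorus.mFourierCoeff (divSinMul p t) (y - x)‖
        + ‖UnitAddTorus.mFourierCoeff (cosMul p t) (y - x)‖ ≤ K ∧
      ‖UnitAddTorus.mFourierCoeff (mulSinMul p t) (y - x)‖
        + ‖UnitAddTorus.mFourierCoeff (cosMul p t) (y - x)‖ ≤ K) :
    commNorm p t f g ≤ K * ‖f‖ * ‖g‖ := by
  refine (commNorm_le p t f g).trans ?_
  have h1 := abs_apply_ofL1_le ((sigmaLeft (ofL1 g)) ∘L evolve p t) (K := K * ‖g‖) f
    fun x hx => by
      have h2 := abs_apply_ofL1_le (-(sigmaLeft (evolve p t (delta x (f x))))) (K := K * ‖f x‖) g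
        fun y hy => by
          rw [neg_apply, sigmaLeft_apply, abs_neg, sigma_swap, abs_neg]
          exact abs_sigma_evolve_delta_le p (h x hx y hy).1 (h x hx y hy).2 _ _
      rw [neg_apply, sigmaLeft_apply, abs_neg, sigma_swap, abs_neg] at h2
      rw [ContinuousLinearMap.comp_apply, sigmaLeft_apply]
      linarith
  rw [ContinuousLinearMap.comp_apply, sigmaLeft_apply] at h1
  linarith


/-! ### Complex shifts of the momentum, on the level of Fourier coefficients -/

open UnitAddTorus

lemma norm_mFourier_apply_le (n : Z2) (θ : UnitAddTorus (Fin 2)) : ‖mFourier n θ‖ ≤ 1 :=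
  ((mFourier n).norm_coe_le_norm θ).trans_eq mFourier_norm

lemma norm_mFourierCoeff_le {φ : C(UnitAddTorus (Fin 2), ℂ)} {M : ℝ} (h : ∀ θ, ‖φ θ‖ ≤ M)
    (n : Z2) : ‖mFourierCoeff φ n‖ ≤ M := by
  have hb : ∀ θ, ‖mFourier (-n) θ • φ θ‖ ≤ M := fun θ => by
    rw [norm_smul]
    calc ‖mFourier (-n) θ‖ * ‖φ θ‖ ≤ 1 * M :=
          mul_le_mul (norm_mFourier_apply_le _ _) (h θ) (norm_nonneg _) zero_le_one
      _ = M := one_mul M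
  have h1 := norm_integral_le_of_norm_le_const (μ := torusMeasure) (Filter.Eventually.of_forall hb)
  rw [probReal_univ, mul_one] at h1
  exact h1

/-- The Fourier coefficient as a continuous linear functional. -/
def coeffCLM (n : Z2) : C(UnitAddTorus (Fin 2), ℂ) →L[ℂ] ℂ :=
  LinearMap.mkContinuous
    { toFun := fun φ => multiplier φ (delta 0 1) n
      map_add' := fun φ ψ => by rw [multiplier_add]; rfl
      map_smul' := fun c φ => by rw [multiplier_smul]; rfl } 1
    fun φ => by
      change ‖multiplier φ (delta 0 1) n‖ ≤ _
      rw [multiplier_delta, one_mul, one_mul, sub_zero]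
      exact norm_mFourierCoeff_le φ.norm_coe_le_norm n

lemma coeffCLM_apply (n : Z2) (φ : C(UnitAddTorus (Fin 2), ℂ)) :
    coeffCLM n φ = mFourierCoeff φ n := by
  change multiplier φ (delta 0 1) n = _
  rw [multiplier_delta, one_mul, sub_zero]

lemma coeffCLM_one {n : Z2} (hn : n ≠ 0) : coeffCLM n 1 = 0 := by
  change multiplier 1 (delta 0 1) n = _
  rw [multiplier_one]
  exact lp.single_apply_ne (E := fun _ : Z2 => ℂ) 2 (0 : Z2) (1 : ℂ) hn

lemma coeffCLM_mFourier_mul (m n : Z2) (φ : C(UnitAddTorus (Fin 2), ℂ)) :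
    coeffCLM n (mFourier m * φ) = coeffCLM (n - m) φ := by
  rw [coeffCLM_apply, coeffCLM_apply]
  unfold mFourierCoeff
  congr 1
  ext θ
  rw [show -(n - m) = -n + m by abel, mFourier_add, ContinuousMap.mul_apply, smul_eq_mul,
    smul_eq_mul, mul_assoc]

/-- The weight `e^{η·n}`. -/
def weight (η : Fin 2 → ℝ) (n : Z2) : ℝ := Real.exp (∑ j, η j * n j)

lemma weight_add (η : Fin 2 → ℝ) (m n : Z2) : weight η (m + n) = weight η m * weight η n := by
  rw [weight, weight, weight, ← Real.exp_add, ← Finset.sum_add_distrib]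
  congr 1
  refine Finset.sum_congr rfl fun j _ => ?_
  rw [Pi.add_apply]; push_cast; ring

/-- `ψ` is the function `φ` with complex shifted argument: its Fourier coefficients are those of
`φ` multiplied with `e^{η·n}`. -/
def IsShift (η : Fin 2 → ℝ) (φ ψ : C(UnitAddTorus (Fin 2), ℂ)) : Prop :=
  ∀ n, coeffCLM n ψ = weight η n * coeffCLM n φ

namespace IsShift

variable {η : Fin 2 → ℝ} {φ ψ φ' ψ' : C(UnitAddTorus (Fin 2), ℂ)}

lemma one : IsShift η 1 1 := fun n => by
  by_cases hn : n = 0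
  · subst hn; simp [weight]
  · rw [coeffCLM_one hn, mul_zero]

lemma add (h : IsShift η φ ψ) (h' : IsShift η φ' ψ') : IsShift η (φ + φ') (ψ + ψ') := fun n => by
  rw [map_add, map_add, h n, h' n, mul_add]

lemma sub (h : IsShift η φ ψ) (h' : IsShift η φ' ψ') : IsShift η (φ - φ') (ψ - ψ') := fun n => by
  rw [map_sub, map_sub, h n, h' n, mul_sub]

lemma smul (c : ℂ) (h : IsShift η φ ψ) : IsShift η (c • φ) (c • ψ) := fun n => by
  rw [map_smul, map_smul, h n, smul_eq_mul, smul_eq_mul, mul_left_comm]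

/-- Multiplying by a character translates the coefficients by `m`, and the weight is multiplicative.
-/
lemma mFourier_mul (m : Z2) (h : IsShift η φ ψ) :
    IsShift η (mFourier m * φ) ((weight η m : ℂ) • (mFourier m * ψ)) := fun n => by
  rw [map_smul, coeffCLM_mFourier_mul, coeffCLM_mFourier_mul, h (n - m), smul_eq_mul, ← mul_assoc,
    ← Complex.ofReal_mul, ← weight_add, add_sub_cancel]

lemma hasSum {F F' : ℕ → C(UnitAddTorus (Fin 2), ℂ)} (h : ∀ m, IsShift η (F m) (F' m))
    (hφ : HasSum F φ) (hψ : HasSum F' ψ) : IsShift η φ ψ := fun n => by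
  have h1 := (hφ.mapL (coeffCLM n)).mul_left (weight η n : ℂ)
  have h2 := hψ.mapL (coeffCLM n)
  simp only [h _ n] at h2
  exact h2.unique h1

/-- The algebraic form of the Paley–Wiener argument: a bounded shifted function forces exponential
decay in the direction `η`. -/
lemma norm_mFourierCoeff_le (h : IsShift η φ ψ) {M : ℝ} (hM : ∀ θ, ‖ψ θ‖ ≤ M) (n : Z2) :
    ‖mFourierCoeff φ n‖ ≤ Real.exp (-∑ j, η j * n j) * M := by
  have h1 := h n
  rw [coeffCLM_apply, coeffCLM_apply] at h1
  have h2 := HarmonicLattice.norm_mFourierCoeff_le hM n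
  rw [h1, norm_mul, Complex.norm_real, Real.norm_eq_abs, weight, Real.abs_exp] at h2
  rw [Real.exp_neg, inv_mul_eq_div, le_div_iff₀ (Real.exp_pos _), mul_comm]
  exact h2

end IsShift

/-! ### Complex shifts of γ² and its powers -/

variable (p : Params)

/-- The trigonometric polynomial `γ²` at complex shifted momenta. -/
def gammaSq (η : Fin 2 → ℝ) : C(UnitAddTorus (Fin 2), ℂ) :=
  (p.ω ^ 2 : ℂ) • 1 + ∑ j, (p.lam j : ℂ) • ((2 : ℂ) • 1
    - ((weight η (Pi.single j 1) : ℂ) • mFourier (Pi.single j 1)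
      + (weight η (Pi.single j (-1)) : ℂ) • mFourier (Pi.single j (-1))))

lemma IsShift.gammaSq_mul {η : Fin 2 → ℝ} {φ ψ : C(UnitAddTorus (Fin 2), ℂ)}
    (h : IsShift η φ ψ) : IsShift η (gammaSq p 0 * φ) (gammaSq p η * ψ) := by
  have key : ∀ j : Fin 2, IsShift η
      ((p.lam j : ℂ) • ((2 : ℂ) • φ
        - (mFourier (Pi.single j 1) * φ + mFourier (Pi.single j (-1)) * φ)))
      ((p.lam j : ℂ) • ((2 : ℂ) • ψ
        - ((weight η (Pi.single j 1) : ℂ) • (mFourier (Pi.single j 1) * ψ)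
          + (weight η (Pi.single j (-1)) : ℂ) • (mFourier (Pi.single j (-1)) * ψ)))) :=
    fun j => ((h.smul 2).sub ((h.mFourier_mul _).add (h.mFourier_mul _))).smul _
  have h2 := (h.smul (p.ω ^ 2 : ℂ)).add ((key 0).add (key 1))
  have h0 : ∀ n, weight 0 n = 1 := fun n => by simp [weight]
  convert! h2 using 1
  · simp only [gammaSq, Fin.sum_univ_two, h0, Complex.ofReal_one, one_smul, add_mul, sub_mul,
      smul_mul_assoc, one_mul]
  · simp only [gammaSq, Fin.sum_univ_two, add_mul, sub_mul, smul_mul_assoc, one_mul]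

lemma IsShift.gammaSq_pow (η : Fin 2 → ℝ) (m : ℕ) :
    IsShift η (gammaSq p 0 ^ m) (gammaSq p η ^ m) := by
  induction m with
  | zero => simpa using IsShift.one
  | succ m ih => rw [pow_succ', pow_succ']; exact ih.gammaSq_mul p

/-- A momentum representing a point of the torus. -/
lemma exists_momentum (θ : UnitAddTorus (Fin 2)) :
    ∃ k ∈ zone, ∀ j, θ j = ((k j / (2 * Real.pi) : ℝ) : UnitAddCircle) := by
  have h : ∀ x : UnitAddCircle, ∃ r : ℝ, |r| ≤ 1 / 2 ∧ x = (r : UnitAddCircle) := fun x => by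
    obtain ⟨r, hr, h⟩ := (AddCircle.coe_image_Icc_eq (1 : ℝ) (-(1 / 2))).ge (Set.mem_univ x)
    refine ⟨r, abs_le.2 ⟨hr.1, by linarith [hr.2]⟩, h.symm⟩
  choose r hr h using fun j => h (θ j)
  refine ⟨WithLp.toLp 2 fun j => 2 * Real.pi * r j, fun j => ?_, fun j => ?_⟩
  · obtain ⟨h1, h2⟩ := abs_le.1 (hr j)
    change -Real.pi ≤ 2 * Real.pi * r j ∧ 2 * Real.pi * r j ≤ Real.pi
    constructor <;> nlinarith [Real.pi_pos]
  · rw [h j]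
    congr 1
    change r j = 2 * Real.pi * r j / (2 * Real.pi)
    have := Real.pi_pos
    field_simp

lemma weight_single (η : Fin 2 → ℝ) (j : Fin 2) (a : ℤ) :
    weight η (Pi.single j a) = Real.exp (η j * a) := by
  unfold weight
  congr 1
  rw [Finset.sum_eq_single j]
  · simp
  · intro i _ hi; simp [hi]
  · simp

/-- With the weights e^{±ηⱼ} the two characters add up to 2 cos(kⱼ - iηⱼ), so this is γ² at the
momentum k - iη. -/
lemma gammaSq_apply (η : Fin 2 → ℝ) {θ : UnitAddTorus (Fin 2)} {k : Plane}
    (h : ∀ j, θ j = ((k j / (2 * Real.pi) : ℝ) : UnitAddCircle)) :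
    gammaSq p η θ = ⟨p.ω ^ 2 + ∑ j, 2 * p.lam j * (1 - Real.cos (k j) * Real.cosh (η j)),
      -∑ j, 2 * p.lam j * (Real.sin (k j) * Real.sinh (η j))⟩ := by
  have hm : ∀ (j : Fin 2) (a : ℤ), mFourier (Pi.single j a) θ
      = (Real.cos (a * k j) : ℂ) + (Real.sin (a * k j) : ℂ) * Complex.I := fun j a => by
    have h1 : mFourier (Pi.single j a) θ = fourier a (θ j) := by
      simp only [mFourier, ContinuousMap.coe_mk]
      rw [Finset.prod_eq_single j]
      · simp
      · intro i _ hi; simp [hi]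
      · simp
    rw [h1, h j, fourier_coe_apply]
    have h2 : 2 * (Real.pi : ℂ) * Complex.I * (a : ℂ) * ((k j / (2 * Real.pi) : ℝ) : ℂ)
        / ((1 : ℝ) : ℂ) = ((a * k j : ℝ) : ℂ) * Complex.I := by
      have : (Real.pi : ℂ) ≠ 0 := Complex.ofReal_ne_zero.2 Real.pi_ne_zero
      push_cast
      field_simp
    rw [h2, Complex.exp_mul_I]
    push_cast
    rfl
  simp only [gammaSq, ContinuousMap.add_apply, ContinuousMap.smul_apply, ContinuousMap.sub_apply,
    ContinuousMap.one_apply, Fin.sum_univ_two, hm, weight_single]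
  apply Complex.ext
  · simp [Real.cosh_eq, -Complex.ofReal_cos, -Complex.ofReal_sin, -Complex.ofReal_exp,
      ← Complex.ofReal_pow]
    ring
  · simp [Real.sinh_eq, -Complex.ofReal_cos, -Complex.ofReal_sin, -Complex.ofReal_exp,
      ← Complex.ofReal_pow]
    ring

lemma gammaSq_zero (θ : UnitAddTorus (Fin 2)) : gammaSq p 0 θ = ((gammaTorus p θ : ℝ) : ℂ) ^ 2 := by
  obtain ⟨k, -, h⟩ := exists_momentum θ
  rw [gammaSq_apply p 0 h]
  have h1 : gammaTorus p θ = gamma p k := by rw [← gammaTorus_coe, funext h]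
  have h2 : 0 ≤ p.ω ^ 2 + ∑ j, 2 * p.lam j * (1 - Real.cos (k j)) :=
    add_nonneg (sq_nonneg _) (Finset.sum_nonneg fun j _ =>
      mul_nonneg (by linarith [p.lam_pos j]) (by linarith [Real.cos_le_one (k j)]))
  rw [h1, ← Complex.ofReal_pow, gamma, Real.sq_sqrt h2]
  apply Complex.ext <;> simp [-Complex.ofReal_pow, -Complex.ofReal_add]

/-! ### Power series in `γ²` -/

/-- The power series `∑ aₘ Gᵐ`. -/
def seriesAt (a : ℕ → ℂ) (G : C(UnitAddTorus (Fin 2), ℂ)) : C(UnitAddTorus (Fin 2), ℂ) :=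
  ∑' m, a m • G ^ m

lemma hasSum_seriesAt {a : ℕ → ℂ} (ha : ∀ r : ℝ, 0 ≤ r → Summable fun m => ‖a m‖ * r ^ m)
    (G : C(UnitAddTorus (Fin 2), ℂ)) : HasSum (fun m => a m • G ^ m) (seriesAt a G) := by
  refine Summable.hasSum (Summable.of_norm_bounded (ha ‖G‖ (norm_nonneg _)) fun m => ?_)
  rw [norm_smul]
  exact mul_le_mul_of_nonneg_left (norm_pow_le G m) (norm_nonneg _)

lemma hasSum_seriesAt_apply {a : ℕ → ℂ} (ha : ∀ r : ℝ, 0 ≤ r → Summable fun m => ‖a m‖ * r ^ m)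
    (G : C(UnitAddTorus (Fin 2), ℂ)) (θ : UnitAddTorus (Fin 2)) :
    HasSum (fun m => a m * G θ ^ m) (seriesAt a G θ) :=
  (hasSum_seriesAt ha G).mapL (ContinuousMap.evalCLM ℂ θ)

lemma isShift_seriesAt {a : ℕ → ℂ} (ha : ∀ r : ℝ, 0 ≤ r → Summable fun m => ‖a m‖ * r ^ m)
    (η : Fin 2 → ℝ) : IsShift η (seriesAt a (gammaSq p 0)) (seriesAt a (gammaSq p η)) :=
  IsShift.hasSum (fun m => (IsShift.gammaSq_pow p η m).smul (a m)) (hasSum_seriesAt ha _)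
    (hasSum_seriesAt ha _)

/-- The Taylor coefficients of `z ↦ cos (√z t)`. -/
def cosCoeff (t : ℝ) (m : ℕ) : ℂ := (-1) ^ m * t ^ (2 * m) / (2 * m).factorial

/-- The Taylor coefficients of `z ↦ sin (√z t) / √z`. -/
def sincCoeff (t : ℝ) (m : ℕ) : ℂ := (-1) ^ m * t ^ (2 * m + 1) / (2 * m + 1).factorial

/-- The absolute values form the power series of cosh(|t|√r). -/
lemma summable_cosCoeff (t r : ℝ) (hr : 0 ≤ r) : Summable fun m => ‖cosCoeff t m‖ * r ^ m := by
  have h := (Real.hasSum_cosh (|t| * √r)).summable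
  refine h.congr fun m => ?_
  simp only [cosCoeff, norm_div, norm_mul, norm_pow, norm_neg, norm_one, one_pow, one_mul,
    Complex.norm_real, Real.norm_eq_abs, Complex.norm_natCast]
  rw [mul_pow, pow_mul (√r), Real.sq_sqrt hr]
  ring

lemma summable_sincCoeff (t r : ℝ) (hr : 0 ≤ r) : Summable fun m => ‖sincCoeff t m‖ * r ^ m := by
  refine Summable.of_nonneg_of_le (fun m => by positivity) (fun m => ?_)
    ((summable_cosCoeff t r hr).mul_left |t|)
  simp only [cosCoeff, sincCoeff, norm_div, norm_mul, norm_pow, norm_neg, norm_one, one_pow,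
    one_mul, Complex.norm_real, Real.norm_eq_abs, Complex.norm_natCast]
  rw [← mul_assoc, mul_div_assoc', ← pow_succ']
  gcongr
  omega

/-- The entire function `sin (w t) / w`. -/
def sinDiv (t : ℝ) (w : ℂ) : ℂ := if w = 0 then t else Complex.sin (w * t) / w

lemma hasSum_cosCoeff (t : ℝ) (w : ℂ) :
    HasSum (fun m => cosCoeff t m * (w ^ 2) ^ m) (Complex.cos (w * t)) := by
  convert! Complex.hasSum_cos (w * t) using 2 with m
  rw [cosCoeff, mul_pow, pow_mul w]
  ring

lemma hasSum_sincCoeff (t : ℝ) (w : ℂ) :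
    HasSum (fun m => sincCoeff t m * (w ^ 2) ^ m) (sinDiv t w) := by
  unfold sinDiv
  split_ifs with hw
  · subst hw
    -- At w = 0 only the term m = 0 survives, with 0 ^ 0 = 1.
    convert! hasSum_ite_eq (0 : ℕ) (t : ℂ) using 2 with m
    rcases m with _ | m
    · simp [sincCoeff]
    · simp
  · have h := (Complex.hasSum_sin (w * t)).div_const w
    convert! h using 2 with m
    rw [sincCoeff, mul_pow, pow_succ w (2 * m), pow_mul w]
    field_simp

lemma seriesAt_cosCoeff (t : ℝ) (G : C(UnitAddTorus (Fin 2), ℂ)) {θ : UnitAddTorus (Fin 2)} {w : ℂ}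
    (h : w ^ 2 = G θ) : seriesAt (cosCoeff t) G θ = Complex.cos (w * t) := by
  have h1 := hasSum_seriesAt_apply (summable_cosCoeff t) G θ
  rw [← h] at h1
  exact h1.unique (hasSum_cosCoeff t w)

lemma seriesAt_sincCoeff (t : ℝ) (G : C(UnitAddTorus (Fin 2), ℂ)) {θ : UnitAddTorus (Fin 2)} {w : ℂ}
    (h : w ^ 2 = G θ) : seriesAt (sincCoeff t) G θ = sinDiv t w := by
  have h1 := hasSum_seriesAt_apply (summable_sincCoeff t) G θ
  rw [← h] at h1
  exact h1.unique (hasSum_sincCoeff t w)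

lemma cosMul_eq_seriesAt (t : ℝ) : cosMul p t = seriesAt (cosCoeff t) (gammaSq p 0) := by
  ext θ
  rw [seriesAt_cosCoeff t _ (gammaSq_zero p θ).symm]
  simp [cosMul]

lemma divSinMul_eq_seriesAt (t : ℝ) : divSinMul p t = seriesAt (sincCoeff t) (gammaSq p 0) := by
  ext θ
  have h0 : (gammaTorus p θ : ℂ) ≠ 0 := Complex.ofReal_ne_zero.2 (gammaTorus_pos p θ).ne'
  rw [seriesAt_sincCoeff t _ (gammaSq_zero p θ).symm, sinDiv, if_neg h0]
  simp [divSinMul, div_eq_inv_mul]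

lemma mulSinMul_eq_seriesAt (t : ℝ) :
    mulSinMul p t = gammaSq p 0 * seriesAt (sincCoeff t) (gammaSq p 0) := by
  rw [← divSinMul_eq_seriesAt]
  ext θ
  have h0 : (gammaTorus p θ : ℂ) ≠ 0 := Complex.ofReal_ne_zero.2 (gammaTorus_pos p θ).ne'
  rw [ContinuousMap.mul_apply, gammaSq_zero]
  simp only [divSinMul, mulSinMul, ContinuousMap.coe_mk]
  push_cast
  field_simp

/-! ### Bounds of the entire functions -/

lemma norm_cos_le_exp (z : ℂ) : ‖Complex.cos z‖ ≤ Real.exp |z.im| := by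
  rw [Complex.cos, norm_div, Complex.norm_ofNat, div_le_iff₀ two_pos]
  refine (norm_add_le _ _).trans ?_
  rw [Complex.norm_exp, Complex.norm_exp]
  have h1 : (z * Complex.I).re ≤ |z.im| := by simpa using neg_le_abs z.im
  have h2 : (-z * Complex.I).re ≤ |z.im| := by simpa using le_abs_self z.im
  linarith [Real.exp_le_exp.2 h1, Real.exp_le_exp.2 h2]

lemma norm_sin_le_exp (z : ℂ) : ‖Complex.sin z‖ ≤ Real.exp |z.im| := by
  rw [Complex.sin, norm_div, Complex.norm_ofNat, div_le_iff₀ two_pos, norm_mul, Complex.norm_I,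
    mul_one]
  refine (norm_sub_le _ _).trans ?_
  rw [Complex.norm_exp, Complex.norm_exp]
  have h1 : (z * Complex.I).re ≤ |z.im| := by simpa using neg_le_abs z.im
  have h2 : (-z * Complex.I).re ≤ |z.im| := by simpa using le_abs_self z.im
  linarith [Real.exp_le_exp.2 h1, Real.exp_le_exp.2 h2]

/-- Mean value inequality on the segment from 0 to z, where the derivative cos is bounded by e^{|Im
z|}. -/
lemma norm_sin_le_mul_exp (z : ℂ) : ‖Complex.sin z‖ ≤ ‖z‖ * Real.exp |z.im| := by
  have h := (convex_segment (𝕜 := ℝ) (0 : ℂ) z).norm_image_sub_le_of_norm_deriv_le (𝕜 := ℂ)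
    (f := Complex.sin) (C := Real.exp |z.im|) (fun x _ => Complex.differentiable_sin x) (fun x hx => by
      rw [Complex.deriv_sin]
      refine (norm_cos_le_exp x).trans (Real.exp_le_exp.2 ?_)
      obtain ⟨a, b, ha, hb, hab, rfl⟩ := hx
      have : (a • (0 : ℂ) + b • z).im = b * z.im := by simp
      rw [this, abs_mul, abs_of_nonneg hb]
      exact mul_le_of_le_one_left (abs_nonneg _) (by linarith))
    (left_mem_segment ℝ 0 z) (right_mem_segment ℝ 0 z)
  rw [Complex.sin_zero, sub_zero, sub_zero, mul_comm] at h
  exact h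

/-- The bound has no factor 1/‖w‖, which matters because γ² may vanish at complex momenta. -/
lemma norm_sinDiv_le (t : ℝ) (w : ℂ) : ‖sinDiv t w‖ ≤ |t| * Real.exp (|w.im| * |t|) := by
  unfold sinDiv
  split_ifs with hw
  · subst hw; simp
  · have h := norm_sin_le_mul_exp (w * t)
    have h1 : (w * t).im = w.im * t := by simp
    rw [h1, abs_mul, norm_mul, Complex.norm_real, Real.norm_eq_abs] at h
    rw [norm_div, div_le_iff₀ (norm_pos_iff.2 hw)]
    linarith

lemma norm_sq_mul_sinDiv_le (t : ℝ) (w : ℂ) :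
    ‖w ^ 2 * sinDiv t w‖ ≤ ‖w‖ * Real.exp (|w.im| * |t|) := by
  have h2 : w ^ 2 * sinDiv t w = w * Complex.sin (w * t) := by
    unfold sinDiv
    split_ifs with hw
    · subst hw; simp
    · field_simp
  have h := norm_sin_le_exp (w * t)
  have h1 : (w * t).im = w.im * t := by simp
  rw [h1, abs_mul] at h
  rw [h2, norm_mul]
  gcongr

lemma norm_coeff_cosMul_le {p : Params} {η : Fin 2 → ℝ} {q : ℝ}
    (hq : ∀ θ w, w ^ 2 = gammaSq p η θ → |w.im| ≤ q) (t : ℝ) (n : Z2) :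
    ‖mFourierCoeff (cosMul p t) n‖ ≤ Real.exp (-∑ j, η j * n j) * Real.exp (q * |t|) := by
  rw [cosMul_eq_seriesAt]
  refine (isShift_seriesAt p (summable_cosCoeff t) η).norm_mFourierCoeff_le (fun θ => ?_) n
  -- The root is chosen pointwise. Either sign will do because the functions involved are even in
  -- `w`, and no continuity in `θ` is needed.
  obtain ⟨w, hw⟩ := IsAlgClosed.exists_pow_nat_eq (gammaSq p η θ) two_pos
  rw [seriesAt_cosCoeff t _ hw]
  refine (norm_cos_le_exp _).trans (Real.exp_le_exp.2 ?_)
  have h1 : (w * t).im = w.im * t := by simp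
  rw [h1, abs_mul]
  exact mul_le_mul_of_nonneg_right (hq θ w hw) (abs_nonneg t)

lemma norm_coeff_divSinMul_le {p : Params} {η : Fin 2 → ℝ} {q : ℝ}
    (hq : ∀ θ w, w ^ 2 = gammaSq p η θ → |w.im| ≤ q) (t : ℝ) (n : Z2) :
    ‖mFourierCoeff (divSinMul p t) n‖
      ≤ Real.exp (-∑ j, η j * n j) * (|t| * Real.exp (q * |t|)) := by
  rw [divSinMul_eq_seriesAt]
  refine (isShift_seriesAt p (summable_sincCoeff t) η).norm_mFourierCoeff_le (fun θ => ?_) n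
  obtain ⟨w, hw⟩ := IsAlgClosed.exists_pow_nat_eq (gammaSq p η θ) two_pos
  rw [seriesAt_sincCoeff t _ hw]
  refine (norm_sinDiv_le t w).trans ?_
  gcongr
  exact hq θ w hw

/-- The two entries of the minimum come from |w sin wt| and from |w²| |sin(wt)/w|. The second is the
better one for small t and keeps the final constant at max{1, M}. -/
lemma norm_coeff_mulSinMul_le {p : Params} {η : Fin 2 → ℝ} {q : ℝ}
    (hq : ∀ θ w, w ^ 2 = gammaSq p η θ → |w.im| ≤ q) (t : ℝ) (n : Z2)
    {M : ℝ} (hM : ∀ θ w, w ^ 2 = gammaSq p η θ → ‖w‖ ≤ M) :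
    ‖mFourierCoeff (mulSinMul p t) n‖
      ≤ Real.exp (-∑ j, η j * n j) * (min M (M ^ 2 * |t|) * Real.exp (q * |t|)) := by
  rw [mulSinMul_eq_seriesAt]
  refine ((isShift_seriesAt p (summable_sincCoeff t) η).gammaSq_mul p).norm_mFourierCoeff_le
    (fun θ => ?_) n
  obtain ⟨w, hw⟩ := IsAlgClosed.exists_pow_nat_eq (gammaSq p η θ) two_pos
  rw [ContinuousMap.mul_apply, seriesAt_sincCoeff t _ hw, ← hw]
  have h1 := hq θ w hw
  have h2 := hM θ w hw
  rcases min_choice M (M ^ 2 * |t|) with h | h <;> rw [h]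
  · refine (norm_sq_mul_sinDiv_le t w).trans ?_
    have h3 : 0 ≤ M := (norm_nonneg w).trans h2
    gcongr
  · rw [norm_mul, norm_pow, mul_assoc]
    gcongr
    refine (norm_sinDiv_le t w).trans ?_
    gcongr


open UnitAddTorus

/-! ### Bounds of the square root of `γ²` at complex momenta -/

/-- The hypotheses give (b² - B)(b² + A) = (ab)² - AB ≤ 0. -/
lemma im_sq_le_and_re_sq_le {a b A B : ℝ} (hA : 0 ≤ A) (hB : 0 ≤ B) (h1 : a ^ 2 - b ^ 2 = A - B)
    (h2 : (a * b) ^ 2 ≤ A * B) : b ^ 2 ≤ B ∧ a ^ 2 ≤ A := by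
  have h3 : b ^ 2 ≤ B := by
    by_contra h
    push Not at h
    have h4 : 0 < b ^ 2 := hB.trans_lt h
    nlinarith [mul_pos h4 (sub_pos.2 h)]
  exact ⟨h3, by linarith⟩

variable (p : Params)

/-- By half-angle formulas the shifted γ² is ω² + 4∑ λⱼ sin²((kⱼ - iηⱼ)/2). Its real part splits as
A - B, with A collecting ω² and the squared real parts of the sines, and B their squared imaginary
parts. The imaginary part is controlled by Cauchy–Schwarz, so `im_sq_le_and_re_sq_le` applies; A + B
bounds ‖w‖². -/
lemma sq_bounds_of_sq_eq_gammaSq {η : Fin 2 → ℝ} {μ : ℝ} (hη : ∀ j, |η j| ≤ μ)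
    {θ : UnitAddTorus (Fin 2)} {w : ℂ} (hw : w ^ 2 = gammaSq p η θ) :
    w.im ^ 2 ≤ 4 * (p.lam 0 + p.lam 1) * Real.sinh (μ / 2) ^ 2 ∧
      ‖w‖ ^ 2 ≤ p.ω ^ 2 + 4 * (p.lam 0 + p.lam 1) * Real.cosh (μ / 2) ^ 2 := by
  obtain ⟨k, -, hk⟩ := exists_momentum θ
  rw [gammaSq_apply p η hk] at hw
  have hre := congrArg Complex.re hw
  have him := congrArg Complex.im hw
  simp only [pow_two, Complex.mul_re, Complex.mul_im, Fin.sum_univ_two] at hre him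
  have hcos : ∀ j, Real.cos (k j) = 2 * Real.cos (k j / 2) ^ 2 - 1 := fun j => by
    rw [← Real.cos_two_mul, mul_div_cancel₀ _ two_ne_zero]
  have hsin : ∀ j, Real.sin (k j) = 2 * Real.sin (k j / 2) * Real.cos (k j / 2) := fun j => by
    rw [← Real.sin_two_mul, mul_div_cancel₀ _ two_ne_zero]
  have hcosh : ∀ j, Real.cosh (η j) = Real.cosh (η j / 2) ^ 2 + Real.sinh (η j / 2) ^ 2 :=
    fun j => by rw [← Real.cosh_two_mul, mul_div_cancel₀ _ two_ne_zero]
  have hsinh : ∀ j, Real.sinh (η j) = 2 * Real.sinh (η j / 2) * Real.cosh (η j / 2) :=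
    fun j => by rw [← Real.sinh_two_mul, mul_div_cancel₀ _ two_ne_zero]
  have hle : ∀ j, |η j / 2| ≤ |μ / 2| := fun j => by
    rw [abs_div, abs_div]
    exact div_le_div_of_nonneg_right ((hη j).trans (le_abs_self μ)) (abs_nonneg _)
  have hch : ∀ j, Real.cosh (η j / 2) ^ 2 ≤ Real.cosh (μ / 2) ^ 2 := fun j =>
    pow_le_pow_left₀ (Real.cosh_pos _).le (Real.cosh_le_cosh.2 (hle j)) 2
  have hcs : ∀ x, Real.cosh x ^ 2 = Real.sinh x ^ 2 + 1 := Real.cosh_sq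
  have hsh : ∀ j, Real.sinh (η j / 2) ^ 2 ≤ Real.sinh (μ / 2) ^ 2 := fun j => by
    linarith [hch j, hcs (η j / 2), hcs (μ / 2)]
  have htr : ∀ j, Real.sin (k j / 2) ^ 2 = 1 - Real.cos (k j / 2) ^ 2 := fun j => Real.sin_sq _
  simp only [hcos, hsin, hcosh, hsinh] at hre him
  have l0 := p.lam_pos 0
  have l1 := p.lam_pos 1
  have t0 := htr 0
  have t1 := htr 1
  have c0 := hcs (η 0 / 2)
  have c1 := hcs (η 1 / 2)
  have b0 := hsh 0
  have b1 := hsh 1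
  set L0 := p.lam 0
  set L1 := p.lam 1
  set S0 := Real.sin (k 0 / 2)
  set S1 := Real.sin (k 1 / 2)
  set C0 := Real.cos (k 0 / 2)
  set C1 := Real.cos (k 1 / 2)
  set s0 := Real.sinh (η 0 / 2)
  set s1 := Real.sinh (η 1 / 2)
  set d0 := Real.cosh (η 0 / 2)
  set d1 := Real.cosh (η 1 / 2)
  have key := im_sq_le_and_re_sq_le (a := w.re) (b := w.im)
    (A := p.ω ^ 2 + 4 * (L0 * (S0 * d0) ^ 2 + L1 * (S1 * d1) ^ 2))
    (B := 4 * (L0 * (C0 * s0) ^ 2 + L1 * (C1 * s1) ^ 2)) (by positivity) (by positivity)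
    (by
      simp only [mul_pow, c0, c1, t0, t1]
      simp only [← pow_two, c0, c1] at hre
      rw [hre]; ring)
    (by
      have e : w.re * w.im = -(4 * (L0 * (S0 * d0) * (C0 * s0) + L1 * (S1 * d1) * (C1 * s1))) := by
        linarith
      rw [e]
      -- By Lagrange's identity this is exactly A B - (Re w · Im w)².
      have : 0 ≤ 16 * (L0 * L1) * ((S0 * d0) * (C1 * s1) - (S1 * d1) * (C0 * s0)) ^ 2
          + p.ω ^ 2 * (4 * (L0 * (C0 * s0) ^ 2 + L1 * (C1 * s1) ^ 2)) := by positivity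
      linarith)
  have hB : 4 * (L0 * (C0 * s0) ^ 2 + L1 * (C1 * s1) ^ 2)
      ≤ 4 * (L0 + L1) * Real.sinh (μ / 2) ^ 2 := by
    have e0 : (C0 * s0) ^ 2 ≤ Real.sinh (μ / 2) ^ 2 := by
      rw [mul_pow]
      exact (mul_le_of_le_one_left (sq_nonneg _) (Real.cos_sq_le_one _)).trans b0
    have e1 : (C1 * s1) ^ 2 ≤ Real.sinh (μ / 2) ^ 2 := by
      rw [mul_pow]
      exact (mul_le_of_le_one_left (sq_nonneg _) (Real.cos_sq_le_one _)).trans b1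
    linarith [mul_le_mul_of_nonneg_left e0 l0.le, mul_le_mul_of_nonneg_left e1 l1.le]
  refine ⟨key.1.trans hB, ?_⟩
  have hn : ‖w‖ ^ 2 = w.re ^ 2 + w.im ^ 2 := by
    rw [Complex.sq_norm, Complex.normSq_apply]; ring
  have e0 : (S0 * d0) ^ 2 + (C0 * s0) ^ 2 ≤ Real.cosh (μ / 2) ^ 2 := by
    rw [mul_pow, mul_pow, t0, hcs (μ / 2), c0]
    linarith [sq_nonneg C0]
  have e1 : (S1 * d1) ^ 2 + (C1 * s1) ^ 2 ≤ Real.cosh (μ / 2) ^ 2 := by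
    rw [mul_pow, mul_pow, t1, hcs (μ / 2), c1]
    linarith [sq_nonneg C1]
  rw [hn]
  linarith [mul_le_mul_of_nonneg_left e0 l0.le, mul_le_mul_of_nonneg_left e1 l1.le, key.1, key.2]

/-! ### Small complex shifts to first order -/

lemma abs_cosh_sub_one_le {x : ℝ} (hx : |x| ≤ 1) : |Real.cosh x - 1| ≤ x ^ 2 := by
  have h1 := abs_le.1 (Real.abs_exp_sub_one_sub_id_le hx)
  have h2 := abs_le.1 (Real.abs_exp_sub_one_sub_id_le (x := -x) (by rwa [abs_neg]))
  rw [Real.cosh_eq, abs_le]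
  rw [neg_sq] at h2
  constructor <;> linarith [h1.1, h1.2, h2.1, h2.2]

lemma abs_sinh_sub_le {x : ℝ} (hx : |x| ≤ 1) : |Real.sinh x - x| ≤ x ^ 2 := by
  have h1 := abs_le.1 (Real.abs_exp_sub_one_sub_id_le hx)
  have h2 := abs_le.1 (Real.abs_exp_sub_one_sub_id_le (x := -x) (by rwa [abs_neg]))
  rw [Real.sinh_eq, abs_le]
  rw [neg_sq] at h2
  constructor <;> linarith [h1.1, h1.2, h2.1, h2.2]

lemma gamma_sq (k : Plane) :
    gamma p k ^ 2 = p.ω ^ 2 + ∑ j, 2 * p.lam j * (1 - Real.cos (k j)) := by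
  refine Real.sq_sqrt (add_nonneg (sq_nonneg _) (Finset.sum_nonneg fun j _ =>
    mul_nonneg (by linarith [p.lam_pos j]) (by linarith [Real.cos_le_one (k j)])))

lemma omega_le_gamma (k : Plane) : p.ω ≤ gamma p k := by
  refine Real.le_sqrt_of_sq_le (le_add_of_nonneg_right (Finset.sum_nonneg fun j _ =>
    mul_nonneg (by linarith [p.lam_pos j]) (by linarith [Real.cos_le_one (k j)])))

lemma gamma_pos (k : Plane) : 0 < gamma p k := p.ω_pos.trans_le (omega_le_gamma p k)

/-- The group velocity in direction `u`. -/
def velocityAlong (u : Fin 2 → ℝ) (k : Plane) : ℝ :=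
  ∑ j, u j * (p.lam j * Real.sin (k j) / gamma p k)

lemma abs_velocityAlong_le {u : Fin 2 → ℝ} (hu : ∀ j, |u j| ≤ 1) (k : Plane) :
    |velocityAlong p u k| ≤ (p.lam 0 + p.lam 1) / p.ω := by
  have h : ∀ j, |u j * (p.lam j * Real.sin (k j) / gamma p k)| ≤ p.lam j / p.ω := fun j => by
    rw [abs_mul, abs_div, abs_mul, abs_of_pos (p.lam_pos j), abs_of_pos (gamma_pos p k)]
    have h1 := p.lam_pos j
    have h2 := Real.abs_sin_le_one (k j)
    calc |u j| * (p.lam j * |Real.sin (k j)| / gamma p k)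
        ≤ 1 * (p.lam j * 1 / p.ω) := by
          have h3 := p.ω_pos
          have h4 := gamma_pos p k
          gcongr
          · exact hu j
          · exact omega_le_gamma p k
      _ = p.lam j / p.ω := by ring
  rw [velocityAlong, Fin.sum_univ_two, add_div]
  exact (abs_add_le _ _).trans (add_le_add (h 0) (h 1))

/-- A small complex shift changes the frequency by the group velocity, up to a quadratic error. -/
lemma exists_abs_im_le : ∃ C ε₀ : ℝ, 0 < C ∧ 0 < ε₀ ∧ ε₀ ≤ 1 ∧
    ∀ (ε : ℝ) (u : Fin 2 → ℝ) (k : Plane) (w : ℂ), 0 ≤ ε → ε ≤ ε₀ → (∀ j, |u j| ≤ 1) →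
      w ^ 2 = ⟨p.ω ^ 2 + ∑ j, 2 * p.lam j * (1 - Real.cos (k j) * Real.cosh (ε * u j)),
        -∑ j, 2 * p.lam j * (Real.sin (k j) * Real.sinh (ε * u j))⟩ →
      |w.im| ≤ ε * |velocityAlong p u k| + C * ε ^ 2 := by
  set Λ := p.lam 0 + p.lam 1 with hΛ
  have l0 := p.lam_pos 0
  have l1 := p.lam_pos 1
  have hω := p.ω_pos
  have hΛ0 : 0 < Λ := add_pos l0 l1
  -- The cap on ε gives 2Λε² ≤ ω²/2, which keeps |Re w| ≥ γ/2. In the constant, Λ is the Taylor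
  -- error of sinh, the other summand is the loss in Re w times the largest velocity, and 2/ω comes
  -- from dividing by Re w.
  refine ⟨2 / p.ω * (Λ + 2 * Λ * (Λ / p.ω) / p.ω), min 1 (p.ω ^ 2 / (4 * Λ)), by positivity,
    by positivity, min_le_left _ _, fun ε u k w h0 h1 hu hw => ?_⟩
  set C := 2 / p.ω * (Λ + 2 * Λ * (Λ / p.ω) / p.ω) with hC
  have hε1 : ε ≤ 1 := h1.trans (min_le_left _ _)
  have hε2 : 2 * Λ * ε ^ 2 ≤ p.ω ^ 2 / 2 := by
    have := h1.trans (min_le_right _ _)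
    rw [le_div_iff₀ (by positivity)] at this
    nlinarith
  have hη : ∀ j, |ε * u j| ≤ 1 := fun j => by
    rw [abs_mul, abs_of_nonneg h0]
    exact mul_le_one₀ hε1 (abs_nonneg _) (hu j)
  have hηsq : ∀ j, (ε * u j) ^ 2 ≤ ε ^ 2 := fun j => by
    rw [mul_pow]
    exact mul_le_of_le_one_right (sq_nonneg _) ((sq_le_one_iff_abs_le_one _).2 (hu j))
  have hre := congrArg Complex.re hw
  have him := congrArg Complex.im hw
  simp only [pow_two w, Complex.mul_re, Complex.mul_im] at hre him
  have hγ := gamma_sq p k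
  have hγω := omega_le_gamma p k
  have hγ0 := gamma_pos p k
  have hv := abs_velocityAlong_le p hu k
  have hvm : gamma p k * velocityAlong p u k
      = p.lam 0 * Real.sin (k 0) * u 0 + p.lam 1 * Real.sin (k 1) * u 1 := by
    rw [velocityAlong, Fin.sum_univ_two]; field_simp
  rw [Fin.sum_univ_two] at hre him hγ
  set g := gamma p k
  set m := velocityAlong p u k
  have hc : ∀ j, |2 * p.lam j * (Real.cos (k j) * (Real.cosh (ε * u j) - 1))|
      ≤ 2 * p.lam j * ε ^ 2 := fun j => by
    rw [abs_mul, abs_of_pos (show 0 < 2 * p.lam j by linarith [p.lam_pos j]), abs_mul]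
    refine mul_le_mul_of_nonneg_left ?_ (by linarith [p.lam_pos j])
    calc _ ≤ 1 * (ε * u j) ^ 2 := mul_le_mul (Real.abs_cos_le_one _) (abs_cosh_sub_one_le (hη j))
          (abs_nonneg _) zero_le_one
      _ ≤ ε ^ 2 := by rw [one_mul]; exact hηsq j
  have hs : ∀ j, |p.lam j * (Real.sin (k j) * (Real.sinh (ε * u j) - ε * u j))|
      ≤ p.lam j * ε ^ 2 := fun j => by
    rw [abs_mul, abs_of_pos (p.lam_pos j), abs_mul]
    refine mul_le_mul_of_nonneg_left ?_ (p.lam_pos j).le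
    calc _ ≤ 1 * (ε * u j) ^ 2 := mul_le_mul (Real.abs_sin_le_one _) (abs_sinh_sub_le (hη j))
          (abs_nonneg _) zero_le_one
      _ ≤ ε ^ 2 := by rw [one_mul]; exact hηsq j
  have hR : g ^ 2 - 2 * Λ * ε ^ 2 ≤ w.re ^ 2 := by
    have a0 := (abs_le.1 (hc 0)).2
    have a1 := (abs_le.1 (hc 1)).2
    nlinarith [sq_nonneg w.im]
  have hI : |w.re * w.im| ≤ g * (ε * |m|) + Λ * ε ^ 2 := by
    have e : w.re * w.im = -(ε * (g * m)
        + p.lam 0 * (Real.sin (k 0) * (Real.sinh (ε * u 0) - ε * u 0))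
        + p.lam 1 * (Real.sin (k 1) * (Real.sinh (ε * u 1) - ε * u 1))) := by
      rw [hvm]; linarith
    rw [e, abs_neg]
    refine (abs_add_three _ _ _).trans ?_
    have e2 : |ε * (g * m)| = g * (ε * |m|) := by
      rw [abs_mul, abs_mul, abs_of_nonneg h0, abs_of_pos hγ0]; ring
    rw [e2]
    linarith [hs 0, hs 1]
  have hgω : p.ω ^ 2 ≤ g ^ 2 := pow_le_pow_left₀ hω.le hγω 2
  -- With X = 2Λε²/g one has (g - X)² = g² - 4Λε² + X² ≤ g² - 2Λε², since X² ≤ 2Λε².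
  have hp : g - 2 * Λ * ε ^ 2 / g ≤ |w.re| := by
    refine abs_le_of_sq_le_sq' ?_ (abs_nonneg _) |>.2
    rw [sq_abs]
    refine le_trans ?_ hR
    have e : (g - 2 * Λ * ε ^ 2 / g) ^ 2 = g ^ 2 - 2 * (2 * Λ * ε ^ 2)
        + 2 * Λ * ε ^ 2 * (2 * Λ * ε ^ 2 / g ^ 2) := by field_simp; ring
    have e2 : 2 * Λ * ε ^ 2 / g ^ 2 ≤ 1 := by
      rw [div_le_one (by positivity)]; linarith [sq_nonneg p.ω]
    rw [e]
    linarith [mul_le_mul_of_nonneg_left e2 (show 0 ≤ 2 * Λ * ε ^ 2 by positivity)]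
  have hhalf : 2 * Λ * ε ^ 2 / g ≤ g / 2 := by
    rw [div_le_iff₀ hγ0]; linarith
  -- A larger |Im w|, multiplied by the lower bound for |Re w|, would contradict the bound `hI` for
  -- |Re w · Im w|.
  by_contra hcon
  push Not at hcon
  have hC0 : 0 < C := by positivity
  have hm0 : 0 ≤ ε * |m| := by positivity
  rw [abs_mul] at hI
  have hpos : 0 < g - 2 * Λ * ε ^ 2 / g := by linarith
  have h3 : (g - 2 * Λ * ε ^ 2 / g) * (ε * |m| + C * ε ^ 2) < |w.re| * |w.im| :=
    calc _ < (g - 2 * Λ * ε ^ 2 / g) * |w.im| := mul_lt_mul_of_pos_left hcon hpos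
      _ ≤ |w.re| * |w.im| := mul_le_mul_of_nonneg_right hp (abs_nonneg _)
  have h4 : 2 * Λ * ε ^ 2 / g * (ε * |m|) ≤ 2 * Λ * (Λ / p.ω) / p.ω * ε ^ 2 :=
    calc 2 * Λ * ε ^ 2 / g * (ε * |m|) ≤ 2 * Λ * ε ^ 2 / p.ω * (1 * (Λ / p.ω)) := by
          gcongr
      _ = 2 * Λ * (Λ / p.ω) / p.ω * ε ^ 2 := by ring
  have h5 : (Λ + 2 * Λ * (Λ / p.ω) / p.ω) * ε ^ 2 ≤ g / 2 * (C * ε ^ 2) := by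
    have : g / 2 * (C * ε ^ 2) = g / p.ω * ((Λ + 2 * Λ * (Λ / p.ω) / p.ω) * ε ^ 2) := by
      rw [hC]; ring
    rw [this]
    refine le_mul_of_one_le_left (by positivity) ?_
    rwa [one_le_div hω]
  have h6 : g / 2 * (C * ε ^ 2) ≤ (g - 2 * Λ * ε ^ 2 / g) * (C * ε ^ 2) :=
    mul_le_mul_of_nonneg_right (by linarith) (by positivity)
  generalize 2 * Λ * ε ^ 2 / g = X at *
  linarith

/-! ### The light cone bound -/

lemma setDist_le {A B : Set Plane} {a b : Plane} (ha : a ∈ A) (hb : b ∈ B) :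
    setDist A B ≤ dist a b :=
  csInf_le ⟨0, by rintro _ ⟨x, -, y, -, rfl⟩; exact dist_nonneg⟩ ⟨a, ha, b, hb, rfl⟩

lemma toPlane_sub (x y : Z2) : toPlane (x - y) = toPlane x - toPlane y := by
  ext j; simp [toPlane]

/-- Lets γ sin γt and cos γt share the prefactor max{1, M}, with no additive loss. -/
lemma min_add_one_le {M t : ℝ} (hM : 0 < M) (ht : 0 ≤ t) :
    min M (M ^ 2 * t) + 1 ≤ max 1 M * (t + 1) := by
  rcases le_total M 1 with h | h
  · rw [max_eq_left h]
    have : M ^ 2 * t ≤ 1 * t := by gcongr; exact pow_le_one₀ hM.le h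
    linarith [min_le_right M (M ^ 2 * t)]
  · rw [max_eq_right h]
    rcases le_total (M * t) 1 with h1 | h1
    · nlinarith [min_le_right M (M ^ 2 * t), mul_nonneg (sub_nonneg.2 h) (sub_nonneg.2 h1)]
    · nlinarith [min_le_left M (M ^ 2 * t)]

/-- Shifting along n gives the decay e^{-μ|n|} at the price e^{q|t|}, where q bounds |Im w| and M
bounds ‖w‖. -/
theorem commNorm_le_lightCone (μ : ℝ) (hμ : 0 < μ) : ∃ v C : ℝ,
    0 < v ∧ v ≤ 1 / μ * (1 + 2 * √(p.lam 0 + p.lam 1) * Real.sinh (μ / 2)) ∧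
    0 < C ∧ C < p.ω + 2 * √(p.lam 0 + p.lam 1) * Real.cosh (μ / 2) ∧
    ∀ (t : ℝ) (f g : lp (fun _ : Z2 => ℂ) 1),
      commNorm p t f g ≤ max 1 C * ‖f‖ * ‖g‖ *
        Real.exp (-μ * (setDist (toPlane '' supp f) (toPlane '' supp g) - v * |t|)) := by
  set Λ := p.lam 0 + p.lam 1 with hΛ
  have hω := p.ω_pos
  have hΛ0 : 0 < Λ := add_pos (p.lam_pos 0) (p.lam_pos 1)
  have hs0 : 0 < Real.sinh (μ / 2) := Real.sinh_pos_iff.2 (by positivity)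
  have hc0 := Real.cosh_pos (μ / 2)
  have hsq := Real.sq_sqrt hΛ0.le
  have hsq0 := Real.sqrt_pos.2 hΛ0
  set q := 2 * √Λ * Real.sinh (μ / 2) with hq
  have hq0 : 0 < q := by positivity
  set M := √(p.ω ^ 2 + 4 * Λ * Real.cosh (μ / 2) ^ 2) with hM
  have hM0 : 0 < M := by positivity
  refine ⟨1 / μ * (1 + q), M, by positivity, le_rfl, hM0, ?_, fun t f g => ?_⟩
  -- Strict because √(a² + b²) < a + b for positive a and b.
  · rw [hM, Real.sqrt_lt' (by positivity)]
    have : 0 < p.ω * (√Λ * Real.cosh (μ / 2)) := by positivity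
    nlinarith
  set D := setDist (toPlane '' supp f) (toPlane '' supp g)
  have hE : max 1 M * ‖f‖ * ‖g‖ * Real.exp (-μ * (D - 1 / μ * (1 + q) * |t|))
      = (max 1 M * Real.exp (-μ * (D - 1 / μ * (1 + q) * |t|))) * ‖f‖ * ‖g‖ := by ring
  rw [hE]
  refine commNorm_le_of_coeff p fun x hx y hy => ?_
  set n := y - x with hn
  set N := ‖toPlane n‖ with hN
  have hD : D ≤ N := by
    refine (setDist_le (Set.mem_image_of_mem _ hx) (Set.mem_image_of_mem _ hy)).trans_eq ?_
    rw [dist_comm, dist_eq_norm, ← toPlane_sub]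
  have hN2 : N ^ 2 = (n 0 : ℝ) ^ 2 + (n 1 : ℝ) ^ 2 := by
    rw [hN, EuclideanSpace.norm_sq_eq, Fin.sum_univ_two]
    simp [toPlane]
  have hN0 : 0 ≤ N := norm_nonneg _
  -- For n = 0 division by zero makes the shift vanish, and the identities below still hold.
  set η : Fin 2 → ℝ := fun j => μ * n j / N with hη
  have hη1 : ∀ j, |η j| ≤ μ := fun j => by
    have : |(n j : ℝ)| ≤ N := by
      refine abs_le_of_sq_le_sq ?_ hN0
      fin_cases j
      · simp only [Fin.zero_eta]; nlinarith [sq_nonneg (n 1 : ℝ)]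
      · simp only [Fin.mk_one]; nlinarith [sq_nonneg (n 0 : ℝ)]
    simp only [hη]
    rw [abs_div, abs_mul, abs_of_pos hμ, abs_of_nonneg hN0]
    exact div_le_of_le_mul₀ hN0 hμ.le (by gcongr)
  have hη2 : ∑ j, η j * n j = μ * N := by
    rw [Fin.sum_univ_two]
    have e : η 0 * n 0 + η 1 * n 1 = μ * (N ^ 2 / N) := by rw [hN2]; simp only [hη]; ring
    rw [e, pow_two, mul_self_div_self]
  have hqb : ∀ θ w, w ^ 2 = gammaSq p η θ → |w.im| ≤ q := fun θ w hw => by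
    refine abs_le_of_sq_le_sq ((sq_bounds_of_sq_eq_gammaSq p hη1 hw).1.trans_eq ?_) hq0.le
    rw [hq, mul_pow, mul_pow, hsq]; ring
  have hMb : ∀ θ w, w ^ 2 = gammaSq p η θ → ‖w‖ ≤ M := fun θ w hw =>
    Real.le_sqrt_of_sq_le (sq_bounds_of_sq_eq_gammaSq p hη1 hw).2
  have h1 := norm_coeff_cosMul_le hqb t n
  have h2 := norm_coeff_divSinMul_le hqb t n
  have h3 := norm_coeff_mulSinMul_le hqb t n hMb
  rw [hη2] at h1 h2 h3
  obtain ⟨F, hF⟩ : ∃ F, F = Real.exp (-(μ * N)) * Real.exp (q * |t|) := ⟨_, rfl⟩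
  have hF0 : 0 < F := by rw [hF]; positivity
  -- The factor |t| + 1 is absorbed into e^{|t|}; this is the summand 1 in the velocity (1 + q)/μ.
  have ht := Real.add_one_le_exp |t|
  have hmax : 0 < max 1 M := lt_max_of_lt_left one_pos
  have hK : max 1 M * (Real.exp |t| * F) ≤ max 1 M * Real.exp (-μ * (D - 1 / μ * (1 + q) * |t|)) := by
    refine mul_le_mul_of_nonneg_left ?_ hmax.le
    rw [hF, ← Real.exp_add, ← Real.exp_add]
    refine Real.exp_le_exp.2 ?_
    have e : -μ * (D - 1 / μ * (1 + q) * |t|) = -(μ * D) + (1 + q) * |t| := by field_simp; ring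
    rw [e]
    nlinarith [mul_le_mul_of_nonneg_left hD hμ.le]
  constructor
  · calc _ ≤ (|t| + 1) * F := by
          refine (add_le_add h2 h1).trans_eq ?_
          rw [hF]; ring
      _ ≤ max 1 M * (Real.exp |t| * F) := by
          rw [← mul_assoc]
          refine mul_le_mul_of_nonneg_right ?_ hF0.le
          exact ht.trans (le_mul_of_one_le_left (Real.exp_pos _).le (le_max_left _ _))
      _ ≤ _ := hK
  · calc _ ≤ (min M (M ^ 2 * |t|) + 1) * F := by
          refine (add_le_add h3 h1).trans_eq ?_
          rw [hF]; ring
      _ ≤ max 1 M * (Real.exp |t| * F) := by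
          rw [← mul_assoc]
          refine mul_le_mul_of_nonneg_right ?_ hF0.le
          exact (min_add_one_le hM0 (abs_nonneg t)).trans (mul_le_mul_of_nonneg_left ht hmax.le)
      _ ≤ _ := hK


open scoped ContDiff Topology InnerProductSpace

variable (p : Params)

/-! ### The group velocity -/

/-- The explicit group velocity. -/
def velocity (k : Plane) : Plane := WithLp.toLp 2 fun j => p.lam j * Real.sin (k j) / gamma p k

lemma velocity_apply (k : Plane) (j : Fin 2) :
    velocity p k j = p.lam j * Real.sin (k j) / gamma p k := rfl

lemma inner_velocity (u k : Plane) : ⟪u, velocity p k⟫_ℝ = velocityAlong p u k := by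
  rw [velocityAlong, PiLp.inner_apply]
  refine Finset.sum_congr rfl fun j _ => ?_
  rw [velocity_apply]
  simp [mul_comm]

lemma radicand_pos (k : Plane) : 0 < p.ω ^ 2 + ∑ j, 2 * p.lam j * (1 - Real.cos (k j)) := by
  rw [← gamma_sq]; exact pow_pos (gamma_pos p k) 2

lemma hasGradientAt_gamma (k : Plane) : HasGradientAt (gamma p) (velocity p k) k := by
  rw [hasGradientAt_iff_hasFDerivAt]
  have hj : ∀ j : Fin 2, HasFDerivAt (fun k : Plane => 2 * p.lam j * (1 - Real.cos (k j)))
      ((2 * p.lam j * Real.sin (k j)) • (EuclideanSpace.proj j : Plane →L[ℝ] ℝ)) k := fun j => by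
    have h1 := (EuclideanSpace.proj j : Plane →L[ℝ] ℝ).hasFDerivAt (x := k)
    have h2 := (h1.cos.const_sub 1).const_mul (2 * p.lam j)
    convert! h2 using 1
    ext v
    simp
    ring
  have h := ((hj 0).fun_add (hj 1)).const_add (p.ω ^ 2)
  have e : (fun k : Plane => p.ω ^ 2 + ∑ j, 2 * p.lam j * (1 - Real.cos (k j)))
      = fun k : Plane => p.ω ^ 2 + (2 * p.lam 0 * (1 - Real.cos (k 0))
        + 2 * p.lam 1 * (1 - Real.cos (k 1))) := by
    funext k; rw [Fin.sum_univ_two]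
  rw [← e] at h
  have h3 := h.sqrt (radicand_pos p k).ne'
  convert! h3 using 1
  ext v
  have hg := (gamma_pos p k).ne'
  rw [InnerProductSpace.toDual_apply_apply, PiLp.inner_apply, Fin.sum_univ_two, velocity_apply,
    velocity_apply]
  change _ = (1 / (2 * gamma p k)) * ((2 * p.lam 0 * Real.sin (k 0)) * v 0
    + (2 * p.lam 1 * Real.sin (k 1)) * v 1)
  simp only [RCLike.inner_apply, conj_trivial]
  field_simp

lemma gradient_gamma : gradient (gamma p) = velocity p :=
  gradient_eq (hasGradientAt_gamma p)

lemma contDiff_gamma : ContDiff ℝ ω (gamma p) := by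
  unfold gamma
  refine ContDiff.sqrt ?_ fun k => (radicand_pos p k).ne'
  have h : ∀ j : Fin 2, ContDiff ℝ ω fun k : Plane => k j := fun j =>
    (EuclideanSpace.proj j : Plane →L[ℝ] ℝ).contDiff
  exact contDiff_const.add (ContDiff.sum fun j _ => contDiff_const.mul
    (contDiff_const.sub (Real.contDiff_cos.comp (h j))))

lemma contDiff_velocity : ContDiff ℝ ω (velocity p) := by
  rw [contDiff_euclidean]
  intro j
  have h : ContDiff ℝ ω fun k : Plane => k j := (EuclideanSpace.proj j : Plane →L[ℝ] ℝ).contDiff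
  exact (contDiff_const.mul (Real.contDiff_sin.comp h)).div (contDiff_gamma p)
    fun k => (gamma_pos p k).ne'

lemma differentiable_velocity : Differentiable ℝ (velocity p) :=
  (contDiff_velocity p).differentiable (by simp)

lemma hessian_apply (k : Plane) (i j : Fin 2) :
    hessian p k i j = fderiv ℝ (velocity p) k (EuclideanSpace.single i 1) j := by
  rw [hessian, Matrix.of_apply, iteratedFDeriv_two_apply]
  have h1 : ∀ k, fderiv ℝ (gamma p) k (EuclideanSpace.single j 1) = velocity p k j := fun k => by
    rw [(hasGradientAt_gamma p k).hasFDerivAt.fderiv, InnerProductSpace.toDual_apply_apply,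
      EuclideanSpace.inner_single_right]
    simp
  have h2 : HasFDerivAt (fderiv ℝ (gamma p)) (fderiv ℝ (fderiv ℝ (gamma p)) k) k :=
    (((contDiff_gamma p).fderiv_right (m := ω) le_rfl).differentiable (by simp) k).hasFDerivAt
  have h3 := (ContinuousLinearMap.apply ℝ ℝ
    (EuclideanSpace.single j 1 : Plane)).hasFDerivAt.comp k h2
  have h4 := (EuclideanSpace.proj j : Plane →L[ℝ] ℝ).hasFDerivAt.comp k
    (differentiable_velocity p k).hasFDerivAt
  have h5 := h3.unique (h4.congr_of_eventuallyEq (Filter.Eventually.of_forall h1))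
  exact congrArg (fun L : Plane →L[ℝ] ℝ => L (EuclideanSpace.single i 1)) h5

/-- Degenerate momenta are thus the critical points of the velocity map, which opens the way to
Sard's theorem and the inverse function theorem. -/
lemma det_hessian (k : Plane) : (hessian p k).det = (fderiv ℝ (velocity p) k).det := by
  set b := (EuclideanSpace.basisFun (Fin 2) ℝ).toBasis with hb
  have h : hessian p k = 
      (LinearMap.toMatrix b b (fderiv ℝ (velocity p) k : Plane →ₗ[ℝ] Plane)).transpose := by
    ext i j
    rw [hessian_apply, Matrix.transpose_apply, LinearMap.toMatrix_apply]
    simp [hb]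
  rw [h, Matrix.det_transpose, LinearMap.det_toMatrix]

lemma contDiff_det_hessian : ContDiff ℝ ω fun k => (hessian p k).det := by
  have h : ∀ i j, ContDiff ℝ ω fun k => hessian p k i j := fun i j => by
    simp only [hessian_apply]
    have h1 : ContDiff ℝ ω (fderiv ℝ (velocity p)) := (contDiff_velocity p).fderiv_right le_rfl
    exact (contDiff_euclidean.1 (h1.clm_apply contDiff_const)) j
  simp only [Matrix.det_fin_two]
  exact ((h 0 0).mul (h 1 1)).sub ((h 0 1).mul (h 1 0))

/-- At the origin the sines vanish, so only their own derivatives contribute and the Hessian is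
diag(λⱼ/ω). -/
lemma det_hessian_zero_ne : (hessian p 0).det ≠ 0 := by
  have h : ∀ i j, hessian p 0 i j
      = p.lam j / p.ω * (EuclideanSpace.single i (1 : ℝ) : Plane) j := fun i j => by
    rw [hessian_apply]
    have hinv : DifferentiableAt ℝ (fun k => (gamma p k)⁻¹) 0 :=
      ((contDiff_gamma p).differentiable (by simp) 0).inv (gamma_pos p 0).ne'
    have h1 := ((EuclideanSpace.proj j : Plane →L[ℝ] ℝ).hasFDerivAt (x := (0 : Plane))).sin.mul
      hinv.hasFDerivAt
    have h2 := h1.const_mul (p.lam j)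
    have h3 := (EuclideanSpace.proj j : Plane →L[ℝ] ℝ).hasFDerivAt.comp (0 : Plane)
      (differentiable_velocity p 0).hasFDerivAt
    have h4 := h3.unique (h2.congr_of_eventuallyEq (Filter.Eventually.of_forall fun k => by
      change velocity p k j = p.lam j * (Real.sin (k j) * (gamma p k)⁻¹)
      rw [velocity_apply]; ring))
    have h5 := congrArg (fun L : Plane →L[ℝ] ℝ => L (EuclideanSpace.single i 1)) h4
    have hg : gamma p 0 = p.ω := by
      unfold gamma
      simp [Real.sqrt_sq p.ω_pos.le]
    refine h5.trans ?_
    simp [hg, div_eq_mul_inv]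
  rw [Matrix.det_fin_two, h, h, h, h]
  have := p.ω_pos
  have := p.lam_pos 0
  have := p.lam_pos 1
  simp
  constructor <;> constructor <;> positivity

/-! ### Density of the regular velocities -/

lemma zone_smul {k : Plane} (hk : k ∈ zone) {s : ℝ} (h0 : 0 ≤ s) (h1 : s < 1) (j : Fin 2) :
    |(s • k) j| < Real.pi := by
  have h : |k j| ≤ Real.pi := abs_le.2 (hk j)
  have h2 : (s • k) j = s * k j := rfl
  rw [h2, abs_mul, abs_of_nonneg h0]
  nlinarith [Real.pi_pos, abs_nonneg (k j)]

/-- Along the ray s ↦ s k the determinant is analytic and nonzero at s = 0, so it cannot vanish for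
s accumulating at 1. Taking s < 1 also moves the momentum into the open square. -/
lemma exists_smul_regular {k : Plane} (hk : k ∈ zone) {U : Set Plane} (hU : U ∈ 𝓝 (velocity p k)) :
    ∃ k' : Plane, (∀ j, |k' j| < Real.pi) ∧ (hessian p k').det ≠ 0 ∧ U ∈ 𝓝 (velocity p k') := by
  have han : AnalyticOnNhd ℝ (fun s : ℝ => (hessian p (s • k)).det) Set.univ := by
    have : ContDiff ℝ ω (fun s : ℝ => (hessian p (s • k)).det) :=
      (contDiff_det_hessian p).comp (contDiff_id.smul contDiff_const)
    exact this.analyticOnNhd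
  have hne : ∀ᶠ s in 𝓝[≠] (1 : ℝ), (hessian p (s • k)).det ≠ 0 := by
    by_contra h
    rw [Filter.not_eventually] at h
    have h0 := han.eqOn_zero_of_preconnected_of_frequently_eq_zero isPreconnected_univ
      (Set.mem_univ 1) (h.mono fun s hs => not_not.1 hs) (Set.mem_univ 0)
    simp only [zero_smul] at h0
    exact det_hessian_zero_ne p h0
  have hcont : Continuous fun s : ℝ => velocity p (s • k) :=
    (contDiff_velocity p).continuous.comp (continuous_id.smul continuous_const)
  have hUs : ∀ᶠ s in 𝓝[<] (1 : ℝ), U ∈ 𝓝 (velocity p (s • k)) := by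
    have h1 : Filter.Tendsto (fun s : ℝ => velocity p (s • k)) (𝓝[<] 1) (𝓝 (velocity p k)) := by
      have := hcont.tendsto 1
      rw [one_smul] at this
      exact this.mono_left nhdsWithin_le_nhds
    exact h1.eventually (eventually_mem_nhds_iff.2 hU)
  have hne' : ∀ᶠ s in 𝓝[<] (1 : ℝ), (hessian p (s • k)).det ≠ 0 :=
    hne.filter_mono (nhdsWithin_mono _ fun s hs => ne_of_lt hs)
  have hmem : ∀ᶠ s in 𝓝[<] (1 : ℝ), s ∈ Set.Ioo (0 : ℝ) 1 := Ioo_mem_nhdsLT zero_lt_one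
  obtain ⟨s, h1, h2, h3⟩ := (hUs.and (hne'.and hmem)).exists
  exact ⟨s • k, zone_smul hk h3.1.le h3.2, h2, h1⟩

/-- The equidimensional case of Sard's theorem. -/
lemma volume_image_degenerate :
    volume (velocity p '' {k | (hessian p k).det = 0}) = 0 :=
  addHaar_image_eq_zero_of_det_fderivWithin_eq_zero volume
    (fun k _ => (differentiable_velocity p k).hasFDerivAt.hasFDerivWithinAt)
    fun k hk => by rw [← det_hessian]; exact hk

lemma V2_union_V3_subset : V2 p ∪ V3 p ⊆ velocity p '' {k | (hessian p k).det = 0} := by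
  rintro v (⟨-, k, hk, rfl⟩ | ⟨k, hk, rfl⟩) <;> rw [gradient_gamma] <;> exact ⟨k, hk.2.1, rfl⟩

/-- Near a regular momentum the velocity map is open, so the nearby velocities fill a set of
positive measure. The degenerate velocities, which contain V₂ and V₃, form a null set and cannot
cover it. -/
theorem velocity_mem_closure_V1 {k : Plane} (hk : k ∈ zone) : velocity p k ∈ closure (V1 p) := by
  rw [mem_closure_iff_nhds]
  intro U hU
  obtain ⟨k', h1, h2, h3⟩ := exists_smul_regular p hk hU
  have hstrict : HasStrictFDerivAt (velocity p) (fderiv ℝ (velocity p) k') k' :=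
    (contDiff_velocity p).contDiffAt.hasStrictFDerivAt (by simp)
  have hdet : (fderiv ℝ (velocity p) k').det ≠ 0 := by rwa [← det_hessian]
  have hmap : Filter.map (velocity p) (𝓝 k') = 𝓝 (velocity p k') :=
    hstrict.map_nhds_eq_of_equiv
      (f' := (fderiv ℝ (velocity p) k').toContinuousLinearEquivOfDetNeZero hdet)
  have hN : ∀ᶠ l in 𝓝 k', (∀ j, |l j| < Real.pi) ∧ (hessian p l).det ≠ 0 ∧ velocity p l ∈ U := by
    refine Filter.Eventually.and ?_ (Filter.Eventually.and ?_ ?_)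
    · rw [Filter.eventually_all]
      intro j
      have : Continuous fun l : Plane => |l j| :=
        ((EuclideanSpace.proj j : Plane →L[ℝ] ℝ).continuous).abs
      exact this.continuousAt.eventually_lt continuousAt_const (h1 j)
    · exact (contDiff_det_hessian p).continuous.continuousAt.eventually_ne h2
    · exact (contDiff_velocity p).continuous.continuousAt h3
  have himg : velocity p '' {l | (∀ j, |l j| < Real.pi) ∧ (hessian p l).det ≠ 0 ∧ velocity p l ∈ U}
      ∈ 𝓝 (velocity p k') := by
    rw [← hmap]
    exact Filter.image_mem_map hN
  have hpos := Measure.measure_pos_of_mem_nhds (volume : Measure Plane) himg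
  obtain ⟨v, ⟨l, hl, rfl⟩, hv⟩ : ∃ v ∈ velocity p '' {l | (∀ j, |l j| < Real.pi) ∧
      (hessian p l).det ≠ 0 ∧ velocity p l ∈ U},
      v ∉ velocity p '' {k | (hessian p k).det = 0} := by
    by_contra hcon
    push Not at hcon
    exact hpos.ne' (measure_mono_null hcon (volume_image_degenerate p))
  refine ⟨velocity p l, hl.2.2, fun h => hv (V2_union_V3_subset p h), l, ⟨fun j => ?_, hl.2.1⟩, ?_⟩
  · exact abs_le.1 (hl.1 j).le
  · rw [gradient_gamma]

/-! ### Convexity of the set of group velocities -/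

/-- Concavity of the geometric mean, which is Cauchy–Schwarz. -/
lemma add_mul_sqrt_le {a b s r s' r' : ℝ} (ha : 0 ≤ a) (hb : 0 ≤ b) (hs : 0 ≤ s) (hr : 0 ≤ r)
    (hs' : 0 ≤ s') (hr' : 0 ≤ r') :
    a * √(s * r) + b * √(s' * r') ≤ √((a * s + b * s') * (a * r + b * r')) := by
  refine Real.le_sqrt_of_sq_le ?_
  rw [Real.sqrt_mul hs, Real.sqrt_mul hs']
  have e1 := Real.sq_sqrt hs
  have e2 := Real.sq_sqrt hr
  have e3 := Real.sq_sqrt hs'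
  have e4 := Real.sq_sqrt hr'
  set x := √s
  set y := √r
  set x' := √s'
  set y' := √r'
  rw [← e1, ← e2, ← e3, ← e4]
  nlinarith [mul_nonneg (mul_nonneg ha hb) (sq_nonneg (x * y' - x' * y))]

/-- The condition that characterizes the group velocities `v`, with `s = γ⁻²`. -/
def IsVelocityWitness (v : Plane) (s : ℝ) : Prop :=
  0 < s ∧ (∀ j, v j ^ 2 ≤ p.lam j ^ 2 * s) ∧
    (p.ω ^ 2 + 2 * (p.lam 0 + p.lam 1)) * s - 1
      ≤ ∑ j, 2 * √(s * (p.lam j ^ 2 * s - v j ^ 2))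

/-- The conditions are jointly convex in (v, s): λⱼ²s - vⱼ² is concave, and the geometric mean is
concave and monotone. The set is the projection of this convex set to v. -/
lemma convex_isVelocityWitness : Convex ℝ {v | ∃ s, IsVelocityWitness p v s} := by
  rintro v ⟨s, hs, hv, h⟩ v' ⟨s', hs', hv', h'⟩ a b ha hb hab
  have hs2 : 0 < a * s + b * s' := by
    rcases ha.eq_or_lt with rfl | ha'
    · rw [zero_add] at hab; subst hab; simpa using hs'
    · positivity
  have hr : ∀ j, a * (p.lam j ^ 2 * s - v j ^ 2) + b * (p.lam j ^ 2 * s' - v' j ^ 2)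
      ≤ p.lam j ^ 2 * (a * s + b * s') - (a • v + b • v') j ^ 2 := fun j => by
    have e : (a • v + b • v') j = a * v j + b * v' j := rfl
    rw [e]
    obtain rfl : b = 1 - a := by linarith
    nlinarith [mul_nonneg (mul_nonneg ha hb) (sq_nonneg (v j - v' j))]
  have hr0 : ∀ j, 0 ≤ p.lam j ^ 2 * s - v j ^ 2 := fun j => sub_nonneg.2 (hv j)
  have hr0' : ∀ j, 0 ≤ p.lam j ^ 2 * s' - v' j ^ 2 := fun j => sub_nonneg.2 (hv' j)
  refine ⟨a * s + b * s', hs2, fun j => ?_, ?_⟩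
  · have := hr j
    have := mul_nonneg ha (hr0 j)
    have := mul_nonneg hb (hr0' j)
    linarith
  · have hj : ∀ j, a * (2 * √(s * (p.lam j ^ 2 * s - v j ^ 2)))
        + b * (2 * √(s' * (p.lam j ^ 2 * s' - v' j ^ 2)))
        ≤ 2 * √((a * s + b * s') * (p.lam j ^ 2 * (a * s + b * s') - (a • v + b • v') j ^ 2)) :=
      fun j => by
        have h1 := add_mul_sqrt_le ha hb hs.le (hr0 j) hs'.le (hr0' j)
        have h2 := Real.sqrt_le_sqrt (mul_le_mul_of_nonneg_left (hr j) hs2.le)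
        linarith
    rw [Fin.sum_univ_two] at h h' ⊢
    have h1 := mul_le_mul_of_nonneg_left h ha
    have h2 := mul_le_mul_of_nonneg_left h' hb
    have := hj 0
    have := hj 1
    linarith

lemma isVelocityWitness_velocity (k : Plane) :
    IsVelocityWitness p (velocity p k) ((gamma p k ^ 2)⁻¹) := by
  have hg := gamma_pos p k
  have hg2 : 0 < (gamma p k ^ 2)⁻¹ := by positivity
  have hv : ∀ j, velocity p k j ^ 2 = p.lam j ^ 2 * (gamma p k ^ 2)⁻¹ * Real.sin (k j) ^ 2 :=
    fun j => by rw [velocity_apply]; field_simp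
  refine ⟨hg2, fun j => ?_, ?_⟩
  · rw [hv]
    exact mul_le_of_le_one_right (by positivity) (Real.sin_sq_le_one _)
  · have hj : ∀ j, (gamma p k ^ 2)⁻¹ * (p.lam j * Real.cos (k j))
        ≤ √((gamma p k ^ 2)⁻¹ * (p.lam j ^ 2 * (gamma p k ^ 2)⁻¹ - velocity p k j ^ 2)) := fun j => by
      have e : (gamma p k ^ 2)⁻¹ * (p.lam j ^ 2 * (gamma p k ^ 2)⁻¹ - velocity p k j ^ 2)
          = ((gamma p k ^ 2)⁻¹ * (p.lam j * Real.cos (k j))) ^ 2 := by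
        rw [hv, Real.sin_sq]; ring
      rw [e, Real.sqrt_sq_eq_abs]
      exact le_abs_self _
    have e : (p.ω ^ 2 + 2 * (p.lam 0 + p.lam 1)) * (gamma p k ^ 2)⁻¹ - 1
        = 2 * ((gamma p k ^ 2)⁻¹ * (p.lam 0 * Real.cos (k 0)))
          + 2 * ((gamma p k ^ 2)⁻¹ * (p.lam 1 * Real.cos (k 1))) := by
      have h1 := gamma_sq p k
      rw [Fin.sum_univ_two] at h1
      have h2 : gamma p k ^ 2 * (gamma p k ^ 2)⁻¹ = 1 := mul_inv_cancel₀ (by positivity)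
      linear_combination h2 - (gamma p k ^ 2)⁻¹ * h1
    rw [Fin.sum_univ_two, e]
    linarith [hj 0, hj 1]

/-- A zero G of `Φ` makes kⱼ = arcsin(√G vⱼ/λⱼ) a momentum with γ(k)² = G and velocity v. Now Φ(0) =
-ω² < 0, while the witness inequality divided by s says Φ(1/s) ≥ 0, so a zero exists. The inequality
thus suffices, and it, unlike an equation, survives convex combinations. -/
lemma exists_velocity_eq {v : Plane} {s : ℝ} (h : IsVelocityWitness p v s) :
    ∃ k ∈ zone, velocity p k = v := by
  obtain ⟨hs, hv, hsum⟩ := h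
  have hω := p.ω_pos
  set Φ : ℝ → ℝ := fun G => G - p.ω ^ 2 - (2 * (p.lam 0 - √(p.lam 0 ^ 2 - G * v 0 ^ 2))
    + 2 * (p.lam 1 - √(p.lam 1 ^ 2 - G * v 1 ^ 2))) with hΦ
  have hcont : Continuous Φ := by fun_prop
  have h0 : Φ 0 < 0 := by
    have e : Φ 0 = -p.ω ^ 2 := by
      simp only [hΦ, zero_mul, sub_zero, Real.sqrt_sq (p.lam_pos _).le]
      ring
    rw [e]
    exact neg_neg_of_pos (by positivity)
  have h1 : 0 ≤ Φ s⁻¹ := by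
    have e : ∀ j, √(p.lam j ^ 2 - s⁻¹ * v j ^ 2) = s⁻¹ * √(s * (p.lam j ^ 2 * s - v j ^ 2)) :=
      fun j => by
        have : s * (p.lam j ^ 2 * s - v j ^ 2) = s ^ 2 * (p.lam j ^ 2 - s⁻¹ * v j ^ 2) := by
          field_simp
        rw [this, Real.sqrt_mul (sq_nonneg s), Real.sqrt_sq hs.le, inv_mul_cancel_left₀ hs.ne']
    simp only [hΦ, e]
    rw [Fin.sum_univ_two] at hsum
    have h2 := mul_le_mul_of_nonneg_left hsum (inv_pos.2 hs).le
    have h3 : s⁻¹ * s = 1 := inv_mul_cancel₀ hs.ne'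
    have h4 : s⁻¹ * ((p.ω ^ 2 + 2 * (p.lam 0 + p.lam 1)) * s - 1)
        = p.ω ^ 2 + 2 * (p.lam 0 + p.lam 1) - s⁻¹ := by
      linear_combination (p.ω ^ 2 + 2 * (p.lam 0 + p.lam 1)) * h3
    rw [h4] at h2
    linarith
  obtain ⟨G, hG, hG0⟩ := intermediate_value_Icc (inv_pos.2 hs).le hcont.continuousOn
    (show (0 : ℝ) ∈ Set.Icc (Φ 0) (Φ s⁻¹) from ⟨h0.le, h1⟩)
  have hGpos : 0 < G := hG.1.lt_of_ne fun h => by rw [← h] at hG0; exact h0.ne hG0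
  have hGv : ∀ j, G * v j ^ 2 ≤ p.lam j ^ 2 := fun j => by
    calc G * v j ^ 2 ≤ s⁻¹ * (p.lam j ^ 2 * s) :=
          mul_le_mul hG.2 (hv j) (sq_nonneg _) (inv_pos.2 hs).le
      _ = p.lam j ^ 2 := by field_simp
  have hsG := Real.sq_sqrt hGpos.le
  have hsG0 := Real.sqrt_pos.2 hGpos
  have habs : ∀ j, |√G * v j / p.lam j| ≤ 1 := fun j => by
    rw [← sq_le_one_iff_abs_le_one, div_pow, mul_pow, hsG, div_le_one (pow_pos (p.lam_pos j) 2)]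
    exact hGv j
  set k : Plane := WithLp.toLp 2 fun j => Real.arcsin (√G * v j / p.lam j) with hk
  have hkj : ∀ j, k j = Real.arcsin (√G * v j / p.lam j) := fun j => rfl
  have hsin : ∀ j, p.lam j * Real.sin (k j) = √G * v j := fun j => by
    rw [hkj, Real.sin_arcsin (abs_le.1 (habs j)).1 (abs_le.1 (habs j)).2,
      mul_div_cancel₀ _ (p.lam_pos j).ne']
  have hcos : ∀ j, p.lam j * Real.cos (k j) = √(p.lam j ^ 2 - G * v j ^ 2) := fun j => by
    have hl := p.lam_pos j
    rw [hkj, Real.cos_arcsin]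
    have e : p.lam j ^ 2 - G * v j ^ 2 = p.lam j ^ 2 * (1 - (√G * v j / p.lam j) ^ 2) := by
      rw [div_pow, mul_pow, hsG]; field_simp
    rw [e, Real.sqrt_mul (sq_nonneg _), Real.sqrt_sq hl.le]
  have hg : gamma p k = √G := by
    unfold gamma
    congr 1
    rw [Fin.sum_univ_two]
    simp only [hΦ] at hG0
    rw [← hcos, ← hcos] at hG0
    linarith
  refine ⟨k, fun j => ?_, ?_⟩
  · have h1 := Real.neg_pi_div_two_le_arcsin (√G * v j / p.lam j)
    have h2 := Real.arcsin_le_pi_div_two (√G * v j / p.lam j)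
    rw [← hkj] at h1 h2
    constructor <;> linarith [Real.pi_pos]
  · ext j
    rw [velocity_apply, hg, hsin, mul_div_cancel_left₀ _ hsG0.ne']

theorem convex_image_velocity : Convex ℝ (velocity p '' zone) := by
  have h : velocity p '' zone = {v | ∃ s, IsVelocityWitness p v s} := by
    ext v
    constructor
    · rintro ⟨k, -, rfl⟩
      exact ⟨_, isVelocityWitness_velocity p k⟩
    · rintro ⟨s, hs⟩
      exact exists_velocity_eq p hs
  rw [h]
  exact convex_isVelocityWitness p

/-! ### Separation of a point from the moving velocities -/

lemma isCompact_zone : IsCompact zone := by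
  have h := (EuclideanSpace.equiv (Fin 2) ℝ).toHomeomorph.isCompact_preimage.2
    (isCompact_univ_pi fun _ : Fin 2 => isCompact_Icc (a := -Real.pi) (b := Real.pi))
  convert! h using 1
  ext k
  exact ⟨fun h j _ => h j, fun h j => h j trivial⟩

lemma isCompact_image_velocity : IsCompact (velocity p '' zone) :=
  isCompact_zone.image (contDiff_velocity p).continuous

lemma zero_mem_zone : (0 : Plane) ∈ zone := fun j => by
  simp [Real.pi_pos.le]

lemma velocity_neg (k : Plane) : velocity p (-k) = -velocity p k := by
  ext j
  have h : gamma p (-k) = gamma p k := by simp [gamma]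
  rw [velocity_apply, h]
  simp [velocity_apply, neg_div]

lemma neg_mem_zone {k : Plane} (hk : k ∈ zone) : -k ∈ zone := fun j => by
  have := hk j
  exact ⟨neg_le_neg this.2, neg_le.2 (this.1)⟩

lemma setDist_nonneg (A B : Set Plane) : 0 ≤ setDist A B :=
  Real.sInf_nonneg (by rintro _ ⟨x, -, y, -, rfl⟩; exact dist_nonneg)

/-- A point at distance `D` from the moving velocities is separated from them by a line. -/
theorem exists_separating_direction {A : Set Plane} {x : Plane} (hx : x ∈ A) (t : ℝ) :
    ∃ (u : Plane) (h : ℝ), (∀ j, |u j| ≤ 1) ∧ (∀ k ∈ zone, |velocityAlong p u k| ≤ h) ∧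
      |t| * h + setDist A (t • V1 p) ≤ ⟪u, x⟫_ℝ := by
  set Q := t • (velocity p '' zone) with hQ
  have hQne : Q.Nonempty := ⟨_, Set.smul_mem_smul_set (Set.mem_image_of_mem _ zero_mem_zone)⟩
  have hQcvx : Convex ℝ Q := (convex_image_velocity p).smul t
  have hQcpt : IsCompact Q := (isCompact_image_velocity p).smul t
  -- The separating line is orthogonal to the segment from x to its projection q on the convex set.
  obtain ⟨q, hq, hmin⟩ := exists_norm_eq_iInf_of_complete_convex hQne hQcpt.isComplete hQcvx x
  rw [norm_eq_iInf_iff_real_inner_le_zero hQcvx hq] at hmin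
  set D := setDist A (t • V1 p) with hD
  have hDle : D ≤ ‖x - q‖ := by
    obtain ⟨_, ⟨k, hk, rfl⟩, rfl⟩ := hq
    have hcl : IsClosed {v : Plane | D ≤ ‖x - t • v‖} := isClosed_le continuous_const (by fun_prop)
    have hsub : V1 p ⊆ {v : Plane | D ≤ ‖x - t • v‖} := fun v hv => by
      rw [Set.mem_ofPred_eq, ← dist_eq_norm]
      exact setDist_le hx (Set.smul_mem_smul_set hv)
    exact closure_minimal hsub hcl (velocity_mem_closure_V1 p hk)
  -- If x = q this is the zero vector, and the inequalities hold trivially.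
  set u : Plane := ‖x - q‖⁻¹ • (x - q) with hu
  have hunorm : ‖u‖ ≤ 1 := by
    rw [hu, norm_smul, norm_inv, norm_norm]
    exact inv_mul_le_one
  have hu1 : ∀ j, |u j| ≤ 1 := fun j => (PiLp.norm_apply_le u j).trans hunorm
  have hux : ⟪u, x⟫_ℝ = ⟪u, q⟫_ℝ + ‖x - q‖ := by
    have : ⟪u, x - q⟫_ℝ = ‖x - q‖ := by
      rw [hu, real_inner_smul_left, real_inner_self_eq_norm_mul_norm]
      by_cases h0 : ‖x - q‖ = 0
      · rw [h0]; simp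
      · field_simp
    rw [inner_sub_right] at this
    linarith
  have hle : ∀ w ∈ Q, ⟪u, w⟫_ℝ ≤ ⟪u, q⟫_ℝ := fun w hw => by
    have := mul_nonpos_of_nonneg_of_nonpos (inv_nonneg.2 (norm_nonneg (x - q))) (hmin w hw)
    rw [← real_inner_smul_left, ← hu, inner_sub_right] at this
    linarith
  have hall : ∀ k ∈ zone, |t| * |velocityAlong p u k| ≤ ⟪u, q⟫_ℝ := fun k hk => by
    rw [← abs_mul, ← inner_velocity, ← real_inner_smul_right, abs_le']
    refine ⟨hle _ (Set.smul_mem_smul_set (Set.mem_image_of_mem _ hk)), ?_⟩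
    -- The velocity set is symmetric because γ is even, so a one-sided bound controls the absolute
    -- value.
    rw [← inner_neg_right, ← smul_neg, ← velocity_neg]
    exact hle _ (Set.smul_mem_smul_set (Set.mem_image_of_mem _ (neg_mem_zone hk)))
  rcases eq_or_ne t 0 with rfl | ht
  · refine ⟨u, (p.lam 0 + p.lam 1) / p.ω, hu1, fun k _ => abs_velocityAlong_le p hu1 k, ?_⟩
    have := hall 0 zero_mem_zone
    rw [abs_zero, zero_mul] at this ⊢
    linarith
  · refine ⟨u, ⟪u, q⟫_ℝ / |t|, hu1, fun k hk => ?_, ?_⟩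
    · rw [le_div_iff₀ (abs_pos.2 ht), mul_comm]
      exact hall k hk
    · rw [mul_div_cancel₀ _ (abs_pos.2 ht).ne']
      linarith


open scoped InnerProductSpace

/-! ### Exponential decay outside the range of the group velocities -/

/-- The shift has size ε along the separating direction: the first-order growth is beaten by the
separation D, the second-order growth by δ|t| ≤ D. -/
theorem commNorm_le_outside (p : Params) (δ : ℝ) (hδ : 0 < δ) : ∃ C μ : ℝ, 0 < C ∧ 0 < μ ∧
    ∀ (t : ℝ) (f g : lp (fun _ : Z2 => ℂ) 1),
      δ * |t| ≤ setDist (toPlane '' (supp f - supp g)) (t • V1 p) →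
      commNorm p t f g ≤
        C * ‖f‖ * ‖g‖ * Real.exp (-μ * setDist (toPlane '' (supp f - supp g)) (t • V1 p)) := by
  obtain ⟨B, ε₀, hB, hε₀, hε₀1, hIm⟩ := exists_abs_im_le p
  set ε := min ε₀ (δ / (2 * B)) with hε
  have hε0 : 0 < ε := lt_min hε₀ (by positivity)
  have hεδ : B * ε ≤ δ / 2 := by
    have := min_le_right ε₀ (δ / (2 * B))
    rw [← hε, le_div_iff₀ (by positivity)] at this
    linarith
  set M := √(p.ω ^ 2 + 4 * (p.lam 0 + p.lam 1) * Real.cosh (1 / 2) ^ 2) with hM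
  have hM0 : 0 ≤ M := Real.sqrt_nonneg _
  -- Half of the rate ε is spent on the quadratic error and a further quarter on the factor |t|. The
  -- constant collects γ⁻¹ sin γt, cos γt and γ sin γt in this order.
  refine ⟨4 / (ε * δ) + 1 + M, ε / 4, by positivity, by positivity, fun t f g hdist => ?_⟩
  set D := setDist (toPlane '' (supp f - supp g)) (t • V1 p) with hD
  have hD0 : 0 ≤ D := setDist_nonneg _ _
  have hE : (4 / (ε * δ) + 1 + M) * ‖f‖ * ‖g‖ * Real.exp (-(ε / 4) * D)
      = ((4 / (ε * δ) + 1 + M) * Real.exp (-(ε / 4) * D)) * ‖f‖ * ‖g‖ := by ring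
  rw [hE]
  refine commNorm_le_of_coeff p fun x hx y hy => ?_
  obtain ⟨u, h, hu, hvel, hsep⟩ := exists_separating_direction p
    (Set.mem_image_of_mem toPlane (Set.sub_mem_sub hx hy)) t
  rw [← hD] at hsep
  -- The sign is reversed because `u` points towards x - y while the coefficients are taken at y -
  -- x.
  set η : Fin 2 → ℝ := fun j => ε * -u j with hη
  have hη1 : ∀ j, |η j| ≤ 1 := fun j => by
    simp only [hη]
    rw [abs_mul, abs_neg, abs_of_pos hε0]
    exact mul_le_one₀ ((min_le_left _ _).trans hε₀1) (abs_nonneg _) (hu j)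
  have hη2 : -∑ j, η j * (y - x) j = -(ε * ⟪u, toPlane (x - y)⟫_ℝ) := by
    rw [PiLp.inner_apply, Finset.mul_sum]
    congr 1
    refine Finset.sum_congr rfl fun j _ => ?_
    simp [hη, toPlane]
    ring
  have hqb : ∀ θ w, w ^ 2 = gammaSq p η θ → |w.im| ≤ ε * h + B * ε ^ 2 := fun θ w hw => by
    obtain ⟨k, hk, hkθ⟩ := exists_momentum θ
    rw [gammaSq_apply p η hkθ] at hw
    refine (hIm ε (fun j => -u j) k w hε0.le (min_le_left _ _)
      (fun j => by rw [abs_neg]; exact hu j) hw).trans ?_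
    have e : velocityAlong p (fun j => -u j) k = -velocityAlong p u k := by
      simp [velocityAlong, neg_add_rev, add_comm]
    rw [e, abs_neg]
    gcongr
    exact hvel k hk
  have hMb : ∀ θ w, w ^ 2 = gammaSq p η θ → ‖w‖ ≤ M := fun θ w hw =>
    Real.le_sqrt_of_sq_le (sq_bounds_of_sq_eq_gammaSq p hη1 hw).2
  have h1 := norm_coeff_cosMul_le hqb t (y - x)
  have h2 := norm_coeff_divSinMul_le hqb t (y - x)
  have h3 := norm_coeff_mulSinMul_le hqb t (y - x) hMb
  rw [hη2] at h1 h2 h3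
  obtain ⟨F, hF⟩ : ∃ F, F = Real.exp (-(ε * ⟪u, toPlane (x - y)⟫_ℝ))
      * Real.exp ((ε * h + B * ε ^ 2) * |t|) := ⟨_, rfl⟩
  have hF0 : 0 < F := by rw [hF]; positivity
  -- The exponent is at most -εD + Bε²|t|, and Bε²|t| ≤ εδ|t|/2 ≤ εD/2.
  have hFle : F ≤ Real.exp (-(ε / 2) * D) := by
    rw [hF, ← Real.exp_add, Real.exp_le_exp]
    have e1 := mul_le_mul_of_nonneg_left hsep hε0.le
    have e2 : B * ε * (ε * |t|) ≤ δ / 2 * (ε * |t|) :=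
      mul_le_mul_of_nonneg_right hεδ (by positivity)
    have e3 := mul_le_mul_of_nonneg_left hdist hε0.le
    nlinarith
  set P := Real.exp (-(ε / 4) * D) with hP
  have hP0 : 0 < P := Real.exp_pos _
  have hPP : Real.exp (-(ε / 2) * D) = P * P := by rw [hP, ← Real.exp_add]; ring_nf
  have hP1 : P ≤ 1 := Real.exp_le_one_iff.2 (by nlinarith)
  -- Here |t| ≤ D/δ, and z e^{-z} ≤ 1 at z = εD/4.
  have htP : |t| * P ≤ 4 / (ε * δ) := by
    have e1 : ε / 4 * D * P ≤ 1 := by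
      have := Real.add_one_le_exp (ε / 4 * D)
      have e2 : Real.exp (ε / 4 * D) * P = 1 := by
        rw [hP, ← Real.exp_add, neg_mul, add_neg_cancel, Real.exp_zero]
      nlinarith
    rw [le_div_iff₀ (by positivity)]
    have e2 : δ * |t| * (ε * P) ≤ D * (ε * P) := mul_le_mul_of_nonneg_right hdist (by positivity)
    linarith
  rw [hPP] at hFle
  have hFP : F ≤ P := hFle.trans (mul_le_of_le_one_left hP0.le hP1)
  have hc : ‖UnitAddTorus.mFourierCoeff (cosMul p t) (y - x)‖ ≤ P := h1.trans (hF.ge.trans hFP)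
  have h40 : 0 < 4 / (ε * δ) := by positivity
  constructor
  · have hs : ‖UnitAddTorus.mFourierCoeff (divSinMul p t) (y - x)‖ ≤ 4 / (ε * δ) * P :=
      calc _ ≤ |t| * F := h2.trans_eq (by rw [hF]; ring)
        _ ≤ |t| * (P * P) := mul_le_mul_of_nonneg_left hFle (abs_nonneg t)
        _ = |t| * P * P := by ring
        _ ≤ _ := mul_le_mul_of_nonneg_right htP hP0.le
    nlinarith
  · have hg : ‖UnitAddTorus.mFourierCoeff (mulSinMul p t) (y - x)‖ ≤ M * P :=
      calc _ ≤ min M (M ^ 2 * |t|) * F := h3.trans_eq (by rw [hF]; ring)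
        _ ≤ M * P := mul_le_mul (min_le_left _ _) hFP hF0.le hM0
    nlinarith

end

end HarmonicLattice

theorem mainTheorem10 (p : Params) :
    (∀ δ : ℝ, 0 < δ → ∃ C μ : ℝ, 0 < C ∧ 0 < μ ∧
      ∀ (t : ℝ) (f g : lp (fun _ : Z2 => ℂ) 1),
        toPlane '' (supp f - supp g) ⊆ t • V0 p →
        δ * |t| ≤ setDist (toPlane '' (supp f - supp g)) (t • V1 p) →
        commNorm p t f g ≤
          C * ‖f‖ * ‖g‖ * Real.exp (-μ * setDist (toPlane '' (supp f - supp g)) (t • V1 p))) ∧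
    (∀ μ : ℝ, 0 < μ → ∃ v C : ℝ,
      0 < v ∧ v ≤ 1 / μ * (1 + 2 * √(p.lam 0 + p.lam 1) * Real.sinh (μ / 2)) ∧
      0 < C ∧ C < p.ω + 2 * √(p.lam 0 + p.lam 1) * Real.cosh (μ / 2) ∧
      ∀ (t : ℝ) (f g : lp (fun _ : Z2 => ℂ) 1),
        commNorm p t f g ≤
          max 1 C * ‖f‖ * ‖g‖ *
            Real.exp (-μ * (setDist (toPlane '' supp f) (toPlane '' supp g) - v * |t|))) := by
  refine ⟨fun δ hδ => ?_, commNorm_le_lightCone p⟩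
  obtain ⟨C, μ, hC, hμ, h⟩ := commNorm_le_outside p δ hδ
  exact ⟨C, μ, hC, hμ, fun t f g _ => h t f g⟩
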